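/- Let $d\in\mathbb{Z}_+$ and let $f$ be a nonnegative-definite tempered Borel measure on $\mathbb{R}^d$, that is, a (nonnegative) Borel measure with $\int(1+\|x\|)^{-n}f(\mathrm{d}x)<\infty$ for some $n$ and $\int(\varphi*\varphi^*)\,\mathrm{d}f\ge 0$ for every complex Schwartz function $\varphi$, where $\varphi^*(x)=\overline{\varphi(-x)}$. Let $\hat f$ denote its spectral measure, i.e. the tempered Borel measure that is the Fourier transform of $f$: $\int\varphi\,\mathrm{d}\hat f=\int\hat\varphi\,\mathrm{d}f$ for every Schwartz function $\varphi$, with $\hat\varphi(x)=\int_{\mathbb{R}^d}e^{ix\cdot z}\varphi(z)\,\mathrm{d}z$. On a probability space $(\Omega,P)$ let $\eta$ be the Gaussian noise on $\mathbb{R}_+\times\mathbb{R}^d$ which is white in time and has spatial covariance $f$; that is, the Wiener integrals $W_t(\phi)=\int_{(0,t)\times\mathbb{R}^d}\phi(x)\,\eta(\mathrm{d}r\,\mathrm{d}x)$, for $t\ge0$ and real Schwartz functions $\phi$, form a centered Gaussian family with $$\mathrm{Cov}[W_s(\phi_1),W_t(\phi_2)]=(s\wedge t)\,\langle\phi_1,\phi_2*f\rangle_{L^2(\mathbb{R}^d)}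 .$$ For $x\in\mathbb{R}^d$ let $\eta_x$ be the shifted noise, whose Wiener integrals are $W_t(\phi_x)$, where $\phi_x(y)=\phi(y-x)$. Let $L^2(\Omega)$ be the space of square-integrable random variables $G=G(\eta)$ that are measurable functionals of the noise, and associate to each such $G$ the random field $G(x):=G\circ\theta_x:=G(\eta_x)$, $x\in\mathbb{R}^d$. Then $\{G(x)\}_{x\in\mathbb{R}^d}$ is stationary for every $G\in L^2(\Omega)$. Moreover, the following are equivalent: 1. $\{G(x)\}_{x\in\mathbb{R}^d}$ is ergodic for every $G\in L^2(\Omega)$ such that $x\mapsto G(x)$ is continuous in probability; 2. $\hat f\{0\}=0$. Here a stationary field is ergodic if every measurable set $A\subset\mathbb{R}^{\mathbb{R}^d}$ that is invariant, up to null sets of the law of the field, under each spatial shift has probability $0$ or $1$ under that law. -/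

import Mathlib

open MeasureTheory ProbabilityTheory Filter Topology
open scoped SchwartzMap NNReal ENNReal ComplexOrder

noncomputable section

namespace NoiseErgodicity

/-- Euclidean space `ℝ^d`. -/
abbrev E (d : ℕ) : Type := EuclideanSpace ℝ (Fin d)

/-- A Borel measure `f` on `ℝ^d` is nonnegative definite: `∫ (φ * φ^*) df ≥ 0` for every complex
Schwartz function `φ`, where `φ^*(x) = conj (φ (-x))`, so that
`(φ * φ^*)(z) = ∫ φ(x) conj (φ(x - z)) dx`. The inequality is that of `ℂ`:
the integral is real and nonnegative. -/
def IsNonnegDefinite {d : ℕ} (f : Measure (E d)) : Prop :=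
  ∀ φ : 𝓢(E d, ℂ), 0 ≤ ∫ z, (∫ x, φ x * (starRingEnd ℂ) (φ (x - z)) ∂volume) ∂f

/-- The Fourier transform `∫ e^{i x·z} φ(z) dz` of a Schwartz function. -/
def fourierInt {d : ℕ} (φ : 𝓢(E d, ℂ)) (x : E d) : ℂ :=
  ∫ z, Complex.exp (Complex.I * ((inner ℝ x z : ℝ) : ℂ)) * φ z

/-- The measure `ν` is the Fourier transform, in the sense of tempered distributions, of the
measure `f`. -/
def IsFourierTransform {d : ℕ} (f ν : Measure (E d)) : Prop :=
  ∀ φ : 𝓢(E d, ℂ), ∫ z, φ z ∂ν = ∫ x, fourierInt φ x ∂f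

open Classical in
/-- The spectral measure of `f`: the tempered measure that is the Fourier transform of `f`.
It is unique when it exists, and it exists when `f` is tempered and nonnegative definite;
the value `0` is used for all other measures. -/
def spectralMeasure {d : ℕ} (f : Measure (E d)) : Measure (E d) :=
  if h : ∃ ν : Measure (E d), ν.HasTemperateGrowth ∧ IsFourierTransform f ν then h.choose else 0

/-- The index set of the noise: pairs `(t, φ)`, which stand for the space-time function
`1_{(0,t)} ⊗ φ`. -/
abbrev Idx (d : ℕ) : Type := ℝ≥0 × 𝓢(E d, ℝ)

/-- `W` is the Gaussian noise, white in time and with spatial covariance `f`, given through its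
Wiener integrals `W (t, φ) = ∫_{(0,t) × ℝ^d} φ(x) η(dr dx)`: a centered Gaussian family with
`Cov (W (s, φ), W (t, ψ)) = (s ∧ t) ⟨φ, ψ * f⟩_{L²(ℝ^d)}`. -/
structure IsNoise {d : ℕ} {Ω : Type*} [MeasurableSpace Ω] (f : Measure (E d))
    (W : Idx d → Ω → ℝ) (P : Measure Ω) : Prop where
  measurable : ∀ i, Measurable (W i)
  gaussian : IsGaussianProcess W P
  centered : ∀ i, ∫ ω, W i ω ∂P = 0
  covariance_eq : ∀ (s t : ℝ≥0) (φ ψ : 𝓢(E d, ℝ)),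
    cov[W (s, φ), W (t, ψ); P] = ((min s t : ℝ≥0) : ℝ) * ∫ x, φ x * (∫ y, ψ (x - y) ∂f) ∂volume

/-- The shift `η ↦ η_y` of a noise configuration: `η_y(t, φ) = η(t, φ_y)`, with
`φ_y(x) = φ(x - y)`. -/
def shiftNoise {d : ℕ} (y : E d) (η : Idx d → ℝ) : Idx d → ℝ :=
  fun i => η (i.1, SchwartzMap.compSubConstCLM ℝ y i.2)

/-- The random field `x ↦ G ∘ θ_x` attached to the functional `G` of the noise `W`:
`(G ∘ θ_x)(η) = G(η_x)`. -/
def shiftField {d : ℕ} {Ω : Type*} (W : Idx d → Ω → ℝ) (G : (Idx d → ℝ) → ℝ) :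
    E d → Ω → ℝ :=
  fun x ω => G (shiftNoise x (fun i => W i ω))

/-- `G` represents an element of `L²(Ω)`, where `Ω` carries the σ-algebra of the noise: a
measurable functional `G(η)` of the noise which is square integrable. -/
def IsL2Functional {d : ℕ} {Ω : Type*} [MeasurableSpace Ω] (W : Idx d → Ω → ℝ) (P : Measure Ω)
    (G : (Idx d → ℝ) → ℝ) : Prop :=
  Measurable G ∧ MemLp (fun ω => G (fun i => W i ω)) 2 P

/-- Stationarity: all spatial translates of the random field have the same law on `ℝ^(ℝ^d)`
(equivalently, the same finite-dimensional distributions). -/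
def IsStationaryField {d : ℕ} {Ω : Type*} [MeasurableSpace Ω] (P : Measure Ω)
    (X : E d → Ω → ℝ) : Prop :=
  ∀ y : E d, IdentDistrib (fun ω x => X (x + y) ω) (fun ω x => X x ω) P P

/-- Continuity in probability of a random field. -/
def IsContinuousInProbability {d : ℕ} {Ω : Type*} [MeasurableSpace Ω] (P : Measure Ω)
    (X : E d → Ω → ℝ) : Prop :=
  ∀ x : E d, TendstoInMeasure P X (𝓝 x) (X x)

/-- Ergodicity of a random field: under its law on `ℝ^(ℝ^d)`, every measurable set of functions
which is invariant, up to null sets, under each spatial shift has probability `0` or `1`.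
(Invariance up to null sets is essential: a set of the product σ-algebra depends on
countably many coordinates only, so that hardly any set is invariant pointwise.) -/
def IsErgodicField {d : ℕ} {Ω : Type*} [MeasurableSpace Ω] (P : Measure Ω)
    (X : E d → Ω → ℝ) : Prop :=
  ∀ A : Set (E d → ℝ), MeasurableSet A →
    (∀ y : E d, (fun (u : E d → ℝ) (x : E d) => u (x + y)) ⁻¹' A
      =ᵐ[P.map (fun ω x => X x ω)] A) →
    P.map (fun ω x => X x ω) A = 0 ∨ P.map (fun ω x => X x ω) A = 1

end NoiseErgodicity

end

namespace NoiseErgodicity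

open Complex (I)

variable {d : ℕ}

/-! ### Gaussian Schwartz functions -/

/-! Everything rests on testing with modulated Gaussians. If `ν` is the Fourier transform of `f`,
then `∫ exp (-b ‖z‖² + i ⟨u, z⟩) dν` is a constant times the `f`-integral of a Gaussian of width of
order `√b` centred at `-u` (`integral_gaussC_eq`). As `b → ∞` the left side tends to `ν {0}` for
every `u`, so `(2π)⁻ᵈ ν {0}` is the asymptotic density of `f`, that is, the mean covariance seen at
large scales.

The measure `ν` exists by Bochner–Schwartz: the Fourier transforms of `exp (-ε ‖x‖²) f` are
nonnegative functions, tight after division by a fixed polynomial weight, and a limit point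
multiplied back by the weight is `ν`. Stationarity holds because a centered Gaussian law is
determined by its covariance, which is translation invariant.

If `ν {0} = 0`, Gaussian averages over `y` of the covariances between `φ` and `ψ` shifted by `y`
vanish at large scales, so arbitrarily many translates of one trigonometric functional can be made
almost pairwise uncorrelated. Each of them has the same covariance `q` with an invariant event, and
the second moment of their sum grows only linearly in their number; hence `q = 0`. An invariant
event is therefore independent of the whole noise, itself included, and has probability `0` or `1`.

If `ν {0} > 0`, the Wiener integrals of wider and wider Gaussian densities converge in `L²` to the
zero-frequency part of the noise. The limit is centered with variance `(2π)⁻ᵈ ν {0} > 0` and is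
invariant under every shift. Its field is almost surely constant in `x` at each point but random, so
it is continuous in probability and not ergodic. -/

/-- Half of the Gaussian exponent absorbs the polynomial through `x ^ m / m! ≤ exp x`; what remains
is bounded because `b / 2 * (1 + r) ^ 2 - b * r ^ 2 = b - b / 2 * (r - 1) ^ 2`. -/
lemma one_add_pow_mul_exp_neg_le {b : ℝ} (hb : 0 < b) (m : ℕ) {r : ℝ} (hr : 0 ≤ r) :
    (1 + r) ^ m * Real.exp (-b * r ^ 2) ≤ m.factorial * (2 / b) ^ m * Real.exp b := by
  have h1 : (1 + r) ^ m ≤ m.factorial * (2 / b) ^ m * Real.exp (b / 2 * (1 + r) ^ 2) := by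
    have h := Real.pow_div_factorial_le_exp (x := b / 2 * (1 + r) ^ 2) (by positivity) m
    rw [div_le_iff₀ (by positivity), mul_pow] at h
    have h2 : (1 + r) ^ m ≤ ((1 + r) ^ 2) ^ m := by
      gcongr
      nlinarith
    calc (1 + r) ^ m ≤ ((1 + r) ^ 2) ^ m := h2
      _ = (2 / b) ^ m * ((b / 2) ^ m * ((1 + r) ^ 2) ^ m) := by
        rw [← mul_assoc, ← mul_pow]
        field_simp
        simp
      _ ≤ (2 / b) ^ m * (Real.exp (b / 2 * (1 + r) ^ 2) * m.factorial) := by gcongr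
      _ = _ := by ring
  calc (1 + r) ^ m * Real.exp (-b * r ^ 2)
      ≤ (m.factorial * (2 / b) ^ m * Real.exp (b / 2 * (1 + r) ^ 2)) * Real.exp (-b * r ^ 2) := by
        gcongr
    _ = m.factorial * (2 / b) ^ m * Real.exp (b / 2 * (1 + r) ^ 2 + -b * r ^ 2) := by
        rw [mul_assoc, ← Real.exp_add]
    _ ≤ _ := by
        gcongr
        nlinarith [mul_nonneg hb.le (sq_nonneg (r - 1))]

/-- The Gaussian `x ↦ exp (-b ‖x‖²)` as a real Schwartz function. -/
noncomputable def gaussR (d : ℕ) (b : ℝ) (hb : 0 < b) : 𝓢(E d, ℝ) where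
  toFun x := Real.exp (-b * ‖x‖ ^ 2)
  smooth' := Real.contDiff_exp.comp (contDiff_const.mul (contDiff_norm_sq ℝ))
  decay' := by
    intro k n
    have hq : (fun x : E d => -b * ‖x‖ ^ 2).HasTemperateGrowth := by fun_prop
    rcases hq.norm_iteratedFDeriv_le_uniform n with ⟨l, C, hC, hgrowth⟩
    refine ⟨n.factorial * (C + 1) ^ n *
      ((k + l * n).factorial * (2 / b) ^ (k + l * n) * Real.exp b), fun x => ?_⟩
    have hgrowth' (N : ℕ) (hN₁ : 1 ≤ N) (hN₂ : N ≤ n) :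
        ‖iteratedFDeriv ℝ N (fun x : E d => -b * ‖x‖ ^ 2) x‖ ≤ ((C + 1) * (1 + ‖x‖) ^ l) ^ N := by
      refine (hgrowth N hN₂ x).trans ?_
      rw [mul_pow]
      have hN₁' := (lt_of_lt_of_le zero_lt_one hN₁).ne'
      gcongr
      · exact le_trans (by simp) (le_self_pow₀ (by simp [hC]) hN₁')
      · refine le_self_pow₀ (one_le_pow₀ ?_) hN₁'
        simp only [le_add_iff_nonneg_right, norm_nonneg]
    have := norm_iteratedFDeriv_comp_le (𝕜 := ℝ) (g := Real.exp) (N := ((⊤ : ℕ∞) : WithTop ℕ∞))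
      (C := Real.exp (-b * ‖x‖ ^ 2)) Real.contDiff_exp hq.1 (mod_cast le_top) x
      (fun i _ => by
        rw [norm_iteratedFDeriv_eq_norm_iteratedDeriv, iteratedDeriv_eq_iterate,
          Real.iter_deriv_exp, Real.norm_eq_abs, abs_of_pos (Real.exp_pos _)]) hgrowth'
    have hxk : ‖x‖ ^ k ≤ (1 + ‖x‖) ^ k := by gcongr; simp
    calc _ ≤ (1 + ‖x‖) ^ k * (n.factorial * Real.exp (-b * ‖x‖ ^ 2) *
          ((C + 1) * (1 + ‖x‖) ^ l) ^ n) := by gcongr; exact this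
      _ = n.factorial * (C + 1) ^ n * ((1 + ‖x‖) ^ (k + l * n) * Real.exp (-b * ‖x‖ ^ 2)) := by
        rw [mul_pow, pow_add, ← pow_mul]; ring
      _ ≤ _ := by
        exact mul_le_mul_of_nonneg_left (one_add_pow_mul_exp_neg_le hb _ (norm_nonneg x))
          (by positivity)

@[simp] lemma gaussR_apply (b : ℝ) (hb : 0 < b) (x : E d) :
    gaussR d b hb x = Real.exp (-b * ‖x‖ ^ 2) := rfl

lemma hasTemperateGrowth_cexp_inner (u : E d) :
    (fun x : E d => Complex.exp (((inner ℝ u x : ℝ) : ℂ) * I)).HasTemperateGrowth := by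
  have h : (fun t : ℝ => Complex.exp ((t : ℂ) * I)).HasTemperateGrowth := by
    refine ⟨(Complex.ofRealCLM.contDiff.mul contDiff_const).cexp, fun n => ⟨0, 1, fun t => ?_⟩⟩
    have : ∀ n : ℕ, iteratedDeriv n (fun t : ℝ => Complex.exp ((t : ℂ) * I)) =
        fun t : ℝ => I ^ n * Complex.exp ((t : ℂ) * I) := by
      intro n
      induction n with
      | zero => simp
      | succ n ih =>
        rw [iteratedDeriv_succ, ih]
        funext t
        have h1 : HasDerivAt (fun t : ℝ => (t : ℂ) * I) I t := by
          simpa using (Complex.ofRealCLM.hasDerivAt (x := t)).mul_const I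
        rw [(h1.cexp.const_mul (I ^ n)).deriv]
        ring
    rw [norm_iteratedFDeriv_eq_norm_iteratedDeriv, this]
    simp [Complex.norm_exp_ofReal_mul_I]
  exact h.comp (Function.hasTemperateGrowth_inner_right u)

/-- The modulated Gaussian `x ↦ exp (-b ‖x‖² + i ⟨u, x⟩)` as a complex Schwartz function. -/
noncomputable def gaussC (b : ℝ) (hb : 0 < b) (u : E d) : 𝓢(E d, ℂ) :=
  SchwartzMap.smulLeftCLM ℂ (fun x : E d => Complex.exp (((inner ℝ u x : ℝ) : ℂ) * I))
    ((gaussR d b hb).postcompCLM Complex.ofRealCLM)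

lemma gaussC_apply (b : ℝ) (hb : 0 < b) (u x : E d) :
    gaussC b hb u x = Complex.exp (-(b : ℂ) * (‖x‖ : ℂ) ^ 2 + I * ((inner ℝ u x : ℝ) : ℂ)) := by
  rw [gaussC, SchwartzMap.smulLeftCLM_apply_apply (hasTemperateGrowth_cexp_inner u)]
  simp only [SchwartzMap.postcompCLM_apply, gaussR_apply, Complex.ofRealCLM_apply, smul_eq_mul,
    Complex.ofReal_exp, ← Complex.exp_add]
  congr 1
  push_cast
  ring

/-- The total mass `(π / b) ^ (d / 2)` of the Gaussian `exp (-b ‖x‖²)`. -/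
noncomputable def gaussMass (d : ℕ) (b : ℝ) : ℝ := (Real.pi / b) ^ ((d : ℝ) / 2)

lemma gaussMass_pos (d : ℕ) {b : ℝ} (hb : 0 < b) : 0 < gaussMass d b := by
  unfold gaussMass; positivity

lemma integral_cexp_gauss {b : ℝ} (hb : 0 < b) (c : ℂ) (w : E d) :
    ∫ v : E d, Complex.exp (-(b : ℂ) * (‖v‖ : ℂ) ^ 2 + c * ((inner ℝ w v : ℝ) : ℂ)) =
      gaussMass d b * Complex.exp (c ^ 2 * (‖w‖ : ℂ) ^ 2 / (4 * b)) := by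
  have h := GaussianFourier.integral_cexp_neg_mul_sq_norm_add (b := (b : ℂ)) (by simpa) c w
  rw [h, gaussMass, Complex.ofReal_cpow (by positivity)]
  simp

lemma integral_rexp_gauss {b : ℝ} (hb : 0 < b) (c : ℝ) (w : E d) :
    ∫ v : E d, Real.exp (-b * ‖v‖ ^ 2 + c * inner ℝ w v) =
      gaussMass d b * Real.exp (c ^ 2 * ‖w‖ ^ 2 / (4 * b)) := by
  have h := integral_cexp_gauss hb (c : ℂ) w
  rw [← Complex.ofReal_inj, ← integral_complex_ofReal]
  push_cast
  exact h

/-- Modulation becomes translation, and the transform is real and positive. This makes Gaussians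
usable both as test functions for `ν` and as averaging kernels for `f`. -/
lemma fourierInt_gaussC (b : ℝ) (hb : 0 < b) (u x : E d) :
    fourierInt (gaussC b hb u) x =
      ((gaussMass d b * Real.exp (-(1 / (4 * b)) * ‖x + u‖ ^ 2) : ℝ) : ℂ) := by
  have h : ∀ z : E d, Complex.exp (I * ((inner ℝ x z : ℝ) : ℂ)) * gaussC b hb u z =
      Complex.exp (-(b : ℂ) * (‖z‖ : ℂ) ^ 2 + I * ((inner ℝ (x + u) z : ℝ) : ℂ)) := by
    intro z
    rw [gaussC_apply, ← Complex.exp_add, inner_add_left]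
    congr 1
    push_cast
    ring
  simp only [fourierInt, h]
  rw [integral_cexp_gauss hb]
  push_cast
  rw [Complex.I_sq]
  congr 2
  field_simp

/-! ### Existence of the spectral measure -/

lemma isLocallyFiniteMeasure_of_hasTemperateGrowth (f : Measure (E d)) [f.HasTemperateGrowth] :
    IsLocallyFiniteMeasure f := by
  refine ⟨fun x => ⟨Metric.ball x 1, Metric.ball_mem_nhds x one_pos, ?_⟩⟩
  have h := ((gaussR d 1 one_pos).integrable (μ := f)).measure_norm_ge_lt_top
    (Real.exp_pos (-(‖x‖ + 1) ^ 2))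
  refine lt_of_le_of_lt (measure_mono fun y hy => ?_) h
  have hy' : ‖y‖ ≤ ‖x‖ + 1 := by
    have h1 := norm_le_norm_add_norm_sub' y x
    have h2 := mem_ball_iff_norm.1 hy
    linarith
  simp only [Set.mem_ofPred_eq, gaussR_apply, Real.norm_eq_abs, Real.abs_exp, Real.exp_le_exp]
  nlinarith [norm_nonneg y]

lemma sigmaFinite_of_hasTemperateGrowth (f : Measure (E d)) [f.HasTemperateGrowth] :
    SigmaFinite f := by
  have := isLocallyFiniteMeasure_of_hasTemperateGrowth f
  infer_instance

lemma exists_schwartz_eq_fourierInt (φ : 𝓢(E d, ℂ)) :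
    ∃ ψ : 𝓢(E d, ℂ), ∀ x, fourierInt φ x = ψ x := by
  have hc : -(1 / (2 * Real.pi)) ≠ 0 := by
    have := Real.pi_pos
    simp [this.ne']
  -- The dilation by `-1 / (2π)` converts the kernel `e^{-2πi⟨z, x⟩}` into `e^{i⟨x, z⟩}`.
  let e : E d ≃L[ℝ] E d := ContinuousLinearEquiv.smulLeft (Units.mk0 (-(1 / (2 * Real.pi))) hc)
  refine ⟨SchwartzMap.compCLMOfContinuousLinearEquiv ℂ e (FourierTransform.fourier φ), fun x => ?_⟩
  have he : e x = (-(1 / (2 * Real.pi))) • x := rfl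
  rw [SchwartzMap.compCLMOfContinuousLinearEquiv_apply, Function.comp_apply, he,
    SchwartzMap.fourier_coe, Real.fourier_eq', fourierInt]
  congr 1
  funext z
  rw [smul_eq_mul]
  congr 2
  rw [inner_smul_right, real_inner_comm x z]
  have := Real.pi_pos.ne'
  have : -2 * Real.pi * (-(1 / (2 * Real.pi)) * inner ℝ x z) = inner ℝ x z := by field_simp
  rw [this, mul_comm]

lemma integrable_fourierInt (f : Measure (E d)) [f.HasTemperateGrowth] (φ : 𝓢(E d, ℂ)) :
    Integrable (fourierInt φ) f := by
  obtain ⟨ψ, hψ⟩ := exists_schwartz_eq_fourierInt φ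
  rw [funext hψ]
  exact ψ.integrable

/-- The Fourier transform of the finite measure `exp (-ε ‖x‖²) f(dx)`. -/
noncomputable def smoothedSpectral (f : Measure (E d)) (ε : ℝ) (hε : 0 < ε) (z : E d) : ℂ :=
  ∫ x, gaussC ε hε z x ∂f

lemma norm_gaussC (ε : ℝ) (hε : 0 < ε) (z x : E d) :
    ‖gaussC ε hε z x‖ = gaussR d ε hε x := by
  rw [gaussC_apply, Complex.norm_exp, gaussR_apply]
  congr 1
  simp [← Complex.ofReal_pow]

lemma norm_smoothedSpectral_le (f : Measure (E d)) (ε : ℝ) (hε : 0 < ε) (z : E d) :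
    ‖smoothedSpectral f ε hε z‖ ≤ ∫ x, gaussR d ε hε x ∂f := by
  refine (norm_integral_le_integral_norm _).trans_eq ?_
  simp_rw [norm_gaussC]

lemma continuous_smoothedSpectral (f : Measure (E d)) [f.HasTemperateGrowth] (ε : ℝ) (hε : 0 < ε) :
    Continuous (smoothedSpectral f ε hε) := by
  refine continuous_of_dominated (bound := fun x => gaussR d ε hε x)
    (fun z => (gaussC ε hε z).continuous.aestronglyMeasurable) (fun z => ?_)
    (gaussR d ε hε).integrable ?_
  · exact Eventually.of_forall fun x => (norm_gaussC ε hε z x).le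
  · refine Eventually.of_forall fun x => ?_
    simp_rw [gaussC_apply]
    fun_prop

/-- The autocorrelation of a modulated Gaussian is again one, with half the parameter and the same
frequency. Positive definiteness tested at parameter `2 * ε` thus gives the sign of
`smoothedSpectral` at `ε`, pointwise in `z`. -/
lemma integral_gaussC_mul_conj (ε : ℝ) (hε : 0 < ε) (z y : E d) :
    ∫ x, gaussC (2 * ε) (by positivity) z x *
      (starRingEnd ℂ) (gaussC (2 * ε) (by positivity) z (x - y)) =
      gaussMass d (4 * ε) * gaussC ε hε z y := by
  have h : ∀ x : E d, gaussC (2 * ε) (by positivity) z x *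
      (starRingEnd ℂ) (gaussC (2 * ε) (by positivity) z (x - y)) =
      Complex.exp (-(2 * ε : ℝ) * (‖y‖ : ℂ) ^ 2 + I * ((inner ℝ z y : ℝ) : ℂ)) *
      Complex.exp (-((4 * ε : ℝ) : ℂ) * (‖x‖ : ℂ) ^ 2 +
        ((4 * ε : ℝ) : ℂ) * ((inner ℝ y x : ℝ) : ℂ)) := by
    intro x
    rw [gaussC_apply, gaussC_apply, ← Complex.exp_conj, ← Complex.exp_add, ← Complex.exp_add]
    congr 1
    have h1 : ((‖x - y‖ : ℝ) : ℂ) ^ 2 =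
        (‖x‖ : ℂ) ^ 2 - 2 * ((inner ℝ y x : ℝ) : ℂ) + (‖y‖ : ℂ) ^ 2 := by
      have := norm_sub_sq_real x y
      rw [real_inner_comm] at this
      exact_mod_cast congrArg ((↑) : ℝ → ℂ) this
    simp only [map_add, map_mul, map_neg, map_pow, Complex.conj_ofReal, Complex.conj_I,
      inner_sub_right]
    rw [h1]
    push_cast
    ring
  simp_rw [h]
  rw [integral_const_mul, integral_cexp_gauss (by positivity), gaussC_apply, mul_left_comm,
    ← Complex.exp_add]
  congr 2
  have : (ε : ℂ) ≠ 0 := by exact_mod_cast hε.ne'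
  push_cast
  field_simp
  ring

lemma smoothedSpectral_nonneg {f : Measure (E d)} (hf : IsNonnegDefinite f) (ε : ℝ) (hε : 0 < ε)
    (z : E d) : 0 ≤ smoothedSpectral f ε hε z := by
  have h := hf (gaussC (2 * ε) (by positivity) z)
  simp_rw [integral_gaussC_mul_conj ε hε z] at h
  rw [integral_const_mul] at h
  have hm : 0 < gaussMass d (4 * ε) := gaussMass_pos d (by positivity)
  have h2 : smoothedSpectral f ε hε z =
      ((gaussMass d (4 * ε))⁻¹ : ℝ) * (gaussMass d (4 * ε) * ∫ a, gaussC ε hε z a ∂f) := by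
    have : (gaussMass d (4 * ε) : ℂ) ≠ 0 := by exact_mod_cast hm.ne'
    rw [smoothedSpectral]
    push_cast
    field_simp
  rw [h2]
  exact mul_nonneg (by exact_mod_cast (inv_pos.2 hm).le) h

lemma smoothedSpectral_eq_re {f : Measure (E d)} (hf : IsNonnegDefinite f) (ε : ℝ) (hε : 0 < ε)
    (z : E d) : smoothedSpectral f ε hε z = ((smoothedSpectral f ε hε z).re : ℂ) :=
  Complex.ext (by simp)
    (by simpa using (Complex.nonneg_iff.1 (smoothedSpectral_nonneg hf ε hε z)).2.symm)

lemma integral_mul_smoothedSpectral (f : Measure (E d)) [f.HasTemperateGrowth] (ε : ℝ)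
    (hε : 0 < ε) (φ : 𝓢(E d, ℂ)) :
    ∫ z, φ z * smoothedSpectral f ε hε z = ∫ x, gaussR d ε hε x * fourierInt φ x ∂f := by
  have := sigmaFinite_of_hasTemperateGrowth f
  have h_integrable : Integrable (Function.uncurry fun (z x : E d) => φ z * gaussC ε hε z x)
      (volume.prod f) := by
    have h1 : Integrable (fun x => (gaussR d ε hε x : ℂ)) f := (gaussR d ε hε).integrable.ofReal
    refine Integrable.mono ((φ.integrable (μ := volume)).mul_prod h1) ?_ ?_
    · refine Continuous.aestronglyMeasurable ?_
      simp only [Function.uncurry_def, gaussC_apply]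
      fun_prop
    · refine Eventually.of_forall fun p => ?_
      simp only [Function.uncurry_def, norm_mul, norm_gaussC, Complex.norm_real, Real.norm_eq_abs]
      gcongr
      exact le_abs_self _
  simp_rw [smoothedSpectral, ← integral_const_mul]
  rw [integral_integral_swap h_integrable]
  congr 1
  funext x
  rw [fourierInt, ← integral_const_mul]
  congr 1
  funext z
  rw [gaussC_apply, gaussR_apply, Complex.exp_add, real_inner_comm]
  push_cast
  ring

lemma tendsto_integral_mul_smoothedSpectral (f : Measure (E d)) [f.HasTemperateGrowth]
    (φ : 𝓢(E d, ℂ)) :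
    Tendsto (fun n : ℕ => ∫ z, φ z * smoothedSpectral f (1 / ((n : ℝ) + 1)) (by positivity) z)
      atTop (𝓝 (∫ x, fourierInt φ x ∂f)) := by
  simp_rw [integral_mul_smoothedSpectral]
  refine tendsto_integral_of_dominated_convergence (fun x => ‖fourierInt φ x‖) (fun n => ?_)
    (integrable_fourierInt f φ).norm (fun n => ?_) ?_
  · exact (Complex.continuous_ofReal.comp (gaussR d _ _).continuous).aestronglyMeasurable.mul
      (integrable_fourierInt f φ).aestronglyMeasurable
  · refine Eventually.of_forall fun x => ?_
    rw [norm_mul, gaussR_apply, Complex.norm_real, Real.norm_eq_abs, Real.abs_exp]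
    refine mul_le_of_le_one_left (norm_nonneg _) (Real.exp_le_one_iff.2 ?_)
    have : 0 ≤ 1 / ((n : ℝ) + 1) * ‖x‖ ^ 2 := by positivity
    linarith
  · refine Eventually.of_forall fun x => ?_
    have h0 : Tendsto (fun n : ℕ => gaussR d (1 / ((n : ℝ) + 1)) (by positivity) x) atTop
        (𝓝 1) := by
      have h1 : Tendsto (fun n : ℕ => -(1 / ((n : ℝ) + 1)) * ‖x‖ ^ 2) atTop (𝓝 0) := by
        simpa using (tendsto_one_div_add_atTop_nhds_zero_nat (𝕜 := ℝ)).neg.mul_const (‖x‖ ^ 2)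
      simpa [Function.comp_def] using (Real.continuous_exp.tendsto 0).comp h1
    simpa using ((Complex.continuous_ofReal.tendsto 1).comp h0).mul_const (fourierInt φ x)

/-- The true order is `t ^ (-d / 2)`; the cruder integer power suffices and is cancelled exactly by
the factor `t ^ d` of the later Gamma integral. -/
lemma gaussMass_le_of_le_one {t : ℝ} (ht : 0 < t) (ht1 : t ≤ 1) :
    gaussMass d t ≤ gaussMass d 1 * (t ^ d)⁻¹ := by
  unfold gaussMass
  rw [div_one, Real.div_rpow Real.pi_pos.le ht.le, div_eq_mul_inv]
  gcongr
  rw [← Real.rpow_natCast]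
  exact Real.rpow_le_rpow_of_exponent_ge ht ht1 (by
    have : (0 : ℝ) ≤ d := Nat.cast_nonneg d
    linarith)

lemma integrable_gauss_mul_smoothedSpectral {f : Measure (E d)} [f.HasTemperateGrowth] (ε : ℝ)
    (hε : 0 < ε) (t : ℝ) (ht : 0 < t) :
    Integrable (fun z => Real.exp (-t * ‖z‖ ^ 2) * (smoothedSpectral f ε hε z).re) volume := by
  refine (gaussR d t ht).integrable.mul_bdd (c := ∫ x, gaussR d ε hε x ∂f)
    (Complex.continuous_re.comp (continuous_smoothedSpectral f ε hε)).aestronglyMeasurable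
    (Eventually.of_forall fun z => ?_)
  exact (Complex.abs_re_le_norm _).trans (norm_smoothedSpectral_le f ε hε z)

lemma integral_gauss_mul_smoothedSpectral {f : Measure (E d)} [f.HasTemperateGrowth]
    (hf : IsNonnegDefinite f) (ε : ℝ) (hε : 0 < ε) (t : ℝ) (ht : 0 < t) :
    ∫ z, Real.exp (-t * ‖z‖ ^ 2) * (smoothedSpectral f ε hε z).re =
      gaussMass d t *
        ∫ x, Real.exp (-ε * ‖x‖ ^ 2) * Real.exp (-(1 / (4 * t)) * ‖x‖ ^ 2) ∂f := by
  have h := integral_mul_smoothedSpectral f ε hε (gaussC t ht 0)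
  rw [← Complex.ofReal_inj, ← integral_complex_ofReal, ← integral_const_mul,
    ← integral_complex_ofReal]
  refine Eq.trans (integral_congr_ae (Eventually.of_forall fun z => ?_))
    (h.trans (integral_congr_ae (Eventually.of_forall fun x => ?_)))
  · dsimp only
    rw [Complex.ofReal_mul, ← smoothedSpectral_eq_re hf, gaussC_apply]
    simp
  · dsimp only
    rw [fourierInt_gaussC, gaussR_apply]
    push_cast
    simp only [add_zero]
    ring

/-- Parseval turns the left side into an `f`-integral of Gaussians. For `t ≤ 1` the kernel is at
most `exp (-‖x‖² / 4)`, which gives a bound free of `ε`; for `t ≥ 1` monotonicity in `t` reduces to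
`t = 1`. -/
lemma exists_lintegral_gauss_smoothedSpectral_le {f : Measure (E d)} [f.HasTemperateGrowth]
    (hf : IsNonnegDefinite f) :
    ∃ K : ℝ, 0 ≤ K ∧ ∀ (ε : ℝ) (hε : 0 < ε) (t : ℝ), 0 < t →
      ∫⁻ z, ENNReal.ofReal (Real.exp (-t * ‖z‖ ^ 2) * (smoothedSpectral f ε hε z).re) ≤
        ENNReal.ofReal (K * (1 + (t ^ d)⁻¹)) := by
  have hmass := gaussMass_pos d one_pos
  have hnn : ∀ (ε : ℝ) (hε : 0 < ε) (z : E d), 0 ≤ (smoothedSpectral f ε hε z).re :=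
    fun ε hε z => (Complex.nonneg_iff.1 (smoothedSpectral_nonneg hf ε hε z)).1
  set M := ∫ x, Real.exp (-(1 / 4) * ‖x‖ ^ 2) ∂f with hM
  have hM0 : 0 ≤ M := integral_nonneg fun x => (Real.exp_pos _).le
  have small : ∀ (ε : ℝ) (hε : 0 < ε) (t : ℝ), 0 < t → t ≤ 1 →
      ∫⁻ z, ENNReal.ofReal (Real.exp (-t * ‖z‖ ^ 2) * (smoothedSpectral f ε hε z).re) ≤
        ENNReal.ofReal (gaussMass d 1 * M * (t ^ d)⁻¹) := by
    intro ε hε t ht ht1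
    rw [← ofReal_integral_eq_lintegral_ofReal (integrable_gauss_mul_smoothedSpectral ε hε t ht)
      (Eventually.of_forall fun z => mul_nonneg (Real.exp_pos _).le (hnn ε hε z)),
      integral_gauss_mul_smoothedSpectral hf ε hε t ht]
    refine ENNReal.ofReal_le_ofReal ?_
    have h1 : ∫ x, Real.exp (-ε * ‖x‖ ^ 2) * Real.exp (-(1 / (4 * t)) * ‖x‖ ^ 2) ∂f ≤ M := by
      refine integral_mono_of_nonneg (Eventually.of_forall fun x => by positivity)
        (gaussR d (1 / 4) (by norm_num)).integrable (Eventually.of_forall fun x => ?_)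
      simp only [← Real.exp_add, Real.exp_le_exp]
      have h2 : 1 / 4 * ‖x‖ ^ 2 ≤ 1 / (4 * t) * ‖x‖ ^ 2 := by
        gcongr
        linarith
      have h3 : 0 ≤ ε * ‖x‖ ^ 2 := by positivity
      linarith
    calc _ ≤ (gaussMass d 1 * (t ^ d)⁻¹) * M :=
          mul_le_mul (gaussMass_le_of_le_one ht ht1) h1
            (integral_nonneg fun x => by positivity) (by positivity)
      _ = _ := by ring
  refine ⟨gaussMass d 1 * M, by positivity, fun ε hε t ht => ?_⟩
  rcases le_total t 1 with ht1 | ht1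
  · refine (small ε hε t ht ht1).trans (ENNReal.ofReal_le_ofReal ?_)
    gcongr
    linarith
  · calc _ ≤ ∫⁻ z, ENNReal.ofReal (Real.exp (-1 * ‖z‖ ^ 2) * (smoothedSpectral f ε hε z).re) := by
          refine lintegral_mono fun z => ENNReal.ofReal_le_ofReal ?_
          refine mul_le_mul_of_nonneg_right (Real.exp_le_exp.2 ?_) (hnn ε hε z)
          nlinarith [sq_nonneg ‖z‖]
      _ ≤ _ := small ε hε 1 one_pos le_rfl
      _ ≤ _ := by
          refine ENNReal.ofReal_le_ofReal ?_
          have : 0 < (t ^ d)⁻¹ := by positivity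
          refine mul_le_mul_of_nonneg_left ?_ (by positivity)
          simpa using this.le

lemma lintegral_pow_mul_exp_neg_mul_Ioi (n : ℕ) {r : ℝ} (hr : 0 < r) :
    ∫⁻ t in Set.Ioi (0 : ℝ), ENNReal.ofReal (t ^ n * Real.exp (-(r * t))) =
      ENNReal.ofReal (n.factorial * (1 / r) ^ (n + 1)) := by
  have h := Real.integral_rpow_mul_exp_neg_mul_Ioi (a := (n : ℝ) + 1) (by positivity) hr
  have h' : ∫ t in Set.Ioi (0 : ℝ), t ^ n * Real.exp (-(r * t)) =
      n.factorial * (1 / r) ^ (n + 1) := by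
    rw [add_sub_cancel_right] at h
    simp_rw [Real.rpow_natCast] at h
    rw [h, Real.Gamma_nat_eq_factorial, mul_comm]
    congr 1
    exact_mod_cast Real.rpow_natCast (1 / r) (n + 1)
  have h_integrable : IntegrableOn (fun t : ℝ => t ^ n * Real.exp (-(r * t))) (Set.Ioi 0) := by
    by_contra hcon
    rw [integral_undef hcon] at h'
    have : (0 : ℝ) < n.factorial * (1 / r) ^ (n + 1) := by positivity
    linarith
  rw [← h', ofReal_integral_eq_lintegral_ofReal h_integrable]
  filter_upwards [ae_restrict_mem measurableSet_Ioi] with t ht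
  have : (0 : ℝ) < t := ht
  positivity

/-- Subordination: `d! (1 + ‖z‖²)^(-(d+1))` equals `∫₀^∞ t^d e^{-t} e^{-t‖z‖²} dt`, so Gaussian
bounds integrate to a bound for a polynomial weight, uniformly in `ε`. -/
lemma exists_lintegral_weight_smoothedSpectral_le {f : Measure (E d)} [f.HasTemperateGrowth]
    (hf : IsNonnegDefinite f) :
    ∃ C : ℝ≥0, ∀ (ε : ℝ) (hε : 0 < ε),
      ∫⁻ z, ENNReal.ofReal ((1 / (1 + ‖z‖ ^ 2)) ^ (d + 1) * (smoothedSpectral f ε hε z).re) ≤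
        C := by
  obtain ⟨K, hK, hbound⟩ := exists_lintegral_gauss_smoothedSpectral_le hf
  have hnn : ∀ (ε : ℝ) (hε : 0 < ε) (z : E d), 0 ≤ (smoothedSpectral f ε hε z).re :=
    fun ε hε z => (Complex.nonneg_iff.1 (smoothedSpectral_nonneg hf ε hε z)).1
  refine ⟨(K * (d.factorial + 1)).toNNReal, fun ε hε => ?_⟩
  have hcont := continuous_smoothedSpectral f ε hε
  calc ∫⁻ z, ENNReal.ofReal ((1 / (1 + ‖z‖ ^ 2)) ^ (d + 1) * (smoothedSpectral f ε hε z).re)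
      ≤ ∫⁻ z : E d, ∫⁻ t in Set.Ioi (0 : ℝ), ENNReal.ofReal (t ^ d * Real.exp (-t)) *
          ENNReal.ofReal (Real.exp (-t * ‖z‖ ^ 2) * (smoothedSpectral f ε hε z).re) := by
        refine lintegral_mono fun z => ?_
        have h1 : ∀ t ∈ Set.Ioi (0 : ℝ), ENNReal.ofReal (t ^ d * Real.exp (-t)) *
            ENNReal.ofReal (Real.exp (-t * ‖z‖ ^ 2) * (smoothedSpectral f ε hε z).re) =
            ENNReal.ofReal (smoothedSpectral f ε hε z).re *
              ENNReal.ofReal (t ^ d * Real.exp (-((1 + ‖z‖ ^ 2) * t))) := by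
          intro t ht
          have ht' : (0 : ℝ) < t := ht
          rw [← ENNReal.ofReal_mul (by positivity), ← ENNReal.ofReal_mul (hnn ε hε z)]
          congr 1
          have : Real.exp (-((1 + ‖z‖ ^ 2) * t)) = Real.exp (-t) * Real.exp (-t * ‖z‖ ^ 2) := by
            rw [← Real.exp_add]; congr 1; ring
          rw [this]; ring
        rw [setLIntegral_congr_fun measurableSet_Ioi h1, lintegral_const_mul _ (by fun_prop),
          lintegral_pow_mul_exp_neg_mul_Ioi d (by positivity), ← ENNReal.ofReal_mul (hnn ε hε z)]
        refine ENNReal.ofReal_le_ofReal ?_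
        rw [mul_comm]
        refine mul_le_mul_of_nonneg_left (le_mul_of_one_le_left (by positivity) ?_) (hnn ε hε z)
        exact_mod_cast Nat.one_le_iff_ne_zero.2 (Nat.factorial_ne_zero d)
    _ = ∫⁻ t in Set.Ioi (0 : ℝ), ∫⁻ z : E d, ENNReal.ofReal (t ^ d * Real.exp (-t)) *
          ENNReal.ofReal (Real.exp (-t * ‖z‖ ^ 2) * (smoothedSpectral f ε hε z).re) := by
        refine lintegral_lintegral_swap (Measurable.aemeasurable ?_)
        have := hcont.measurable
        simp only [Function.uncurry_def]
        fun_prop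
    _ ≤ ∫⁻ t in Set.Ioi (0 : ℝ), ENNReal.ofReal K * (ENNReal.ofReal (t ^ d * Real.exp (-(1 * t))) +
          ENNReal.ofReal (t ^ 0 * Real.exp (-(1 * t)))) := by
        refine setLIntegral_mono' measurableSet_Ioi fun t ht => ?_
        have ht' : (0 : ℝ) < t := ht
        rw [lintegral_const_mul _ (by fun_prop)]
        refine (mul_le_mul_right (hbound ε hε t ht') _).trans_eq ?_
        rw [← ENNReal.ofReal_add (by positivity) (by positivity),
          ← ENNReal.ofReal_mul (by positivity), ← ENNReal.ofReal_mul hK]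
        congr 1
        field_simp
    _ ≤ _ := by
        rw [lintegral_const_mul _ (by fun_prop), lintegral_add_left (by fun_prop),
          lintegral_pow_mul_exp_neg_mul_Ioi d one_pos, lintegral_pow_mul_exp_neg_mul_Ioi 0 one_pos,
          ← ENNReal.ofReal_add (by positivity) (by positivity), ← ENNReal.ofReal_mul hK]
        simp [ENNReal.ofReal]

/-- The finite measures with density `(1 + ‖z‖²)^(-(d+2))` with respect to the smoothed spectral
measures; they form a tight family. -/
noncomputable def weightedSpectral (f : Measure (E d)) (ε : ℝ) (hε : 0 < ε) : Measure (E d) :=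
  volume.withDensity fun z =>
    ENNReal.ofReal ((1 / (1 + ‖z‖ ^ 2)) ^ (d + 2) * (smoothedSpectral f ε hε z).re)

/-- The spare power of the weight, `d + 2` instead of `d + 1`, gains a factor `1 / (1 + ‖z‖²) ≤ 1 /
(n + 1)` outside the ball of radius `n`. -/
lemma exists_weightedSpectral_tight {f : Measure (E d)} [f.HasTemperateGrowth]
    (hf : IsNonnegDefinite f) :
    ∃ C : ℝ≥0, ∀ (ε : ℝ) (hε : 0 < ε), weightedSpectral f ε hε Set.univ ≤ C ∧
      ∀ n : ℕ, weightedSpectral f ε hε (Metric.closedBall 0 (n : ℝ))ᶜ ≤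
        ((C * (1 / ((n : ℝ≥0) + 1)) : ℝ≥0) : ℝ≥0∞) := by
  obtain ⟨C, hC⟩ := exists_lintegral_weight_smoothedSpectral_le hf
  refine ⟨C, fun ε hε => ?_⟩
  have hnn : ∀ (z : E d), 0 ≤ (smoothedSpectral f ε hε z).re :=
    fun z => (Complex.nonneg_iff.1 (smoothedSpectral_nonneg hf ε hε z)).1
  constructor
  · rw [weightedSpectral, withDensity_apply _ MeasurableSet.univ, Measure.restrict_univ]
    refine le_trans (lintegral_mono fun z => ENNReal.ofReal_le_ofReal ?_) (hC ε hε)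
    refine mul_le_mul_of_nonneg_right ?_ (hnn z)
    refine pow_le_pow_of_le_one (by positivity) ?_ (by omega)
    rw [div_le_one (by positivity)]
    nlinarith [sq_nonneg ‖z‖]
  · intro n
    rw [weightedSpectral, withDensity_apply _ measurableSet_closedBall.compl]
    calc _ ≤ ∫⁻ z in (Metric.closedBall 0 (n : ℝ))ᶜ, ENNReal.ofReal (1 / ((n : ℝ) + 1)) *
          ENNReal.ofReal ((1 / (1 + ‖z‖ ^ 2)) ^ (d + 1) * (smoothedSpectral f ε hε z).re) := by
          refine setLIntegral_mono' measurableSet_closedBall.compl fun z hz => ?_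
          rw [← ENNReal.ofReal_mul (by positivity)]
          refine ENNReal.ofReal_le_ofReal ?_
          rw [pow_succ', mul_assoc]
          refine mul_le_mul_of_nonneg_right ?_ (mul_nonneg (by positivity) (hnn z))
          have hz' : (n : ℝ) < ‖z‖ := by simpa using hz
          refine one_div_le_one_div_of_le (by positivity) ?_
          rcases Nat.eq_zero_or_pos n with rfl | hn
          · simp
          · have : (1 : ℝ) ≤ n := by exact_mod_cast hn
            nlinarith
      _ ≤ ∫⁻ z, ENNReal.ofReal (1 / ((n : ℝ) + 1)) *
          ENNReal.ofReal ((1 / (1 + ‖z‖ ^ 2)) ^ (d + 1) * (smoothedSpectral f ε hε z).re) :=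
          setLIntegral_le_lintegral _ _
      _ ≤ _ := by
          rw [lintegral_const_mul' _ _ ENNReal.ofReal_ne_top, ENNReal.coe_mul, mul_comm]
          refine mul_le_mul' (hC ε hε) (le_of_eq ?_)
          rw [ENNReal.ofReal]
          congr 1
          ext
          rw [Real.coe_toNNReal _ (by positivity)]
          simp

lemma integral_weightedSpectral {f : Measure (E d)} [f.HasTemperateGrowth]
    (hf : IsNonnegDefinite f) (ε : ℝ) (hε : 0 < ε) (φ : E d → ℂ) :
    ∫ z, (((1 + ‖z‖ ^ 2) ^ (d + 2) : ℝ) : ℂ) * φ z ∂(weightedSpectral f ε hε) =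
      ∫ z, φ z * smoothedSpectral f ε hε z := by
  have hnn : ∀ (z : E d), 0 ≤ (smoothedSpectral f ε hε z).re :=
    fun z => (Complex.nonneg_iff.1 (smoothedSpectral_nonneg hf ε hε z)).1
  have hcont := continuous_smoothedSpectral f ε hε
  have h0 : ∀ z : E d, (1 + ‖z‖ ^ 2) ≠ 0 := fun z => by positivity
  rw [weightedSpectral, integral_withDensity_eq_integral_toReal_smul _ (by simp)]
  · congr 1
    funext z
    rw [ENNReal.toReal_ofReal (mul_nonneg (by positivity) (hnn z)), smoothedSpectral_eq_re hf,
      Complex.ofReal_re, Complex.real_smul, ← mul_assoc, ← Complex.ofReal_mul, mul_comm (φ z)]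
    congr 2
    rw [mul_right_comm, ← mul_pow, one_div_mul_cancel (h0 z), one_pow, one_mul]
  · have := hcont.measurable
    fun_prop

/-- Bochner–Schwartz theorem: a nonnegative definite tempered measure has a spectral measure. -/
theorem exists_isFourierTransform (f : Measure (E d)) [f.HasTemperateGrowth]
    (hf : IsNonnegDefinite f) :
    ∃ ν : Measure (E d), ν.HasTemperateGrowth ∧ IsFourierTransform f ν := by
  obtain ⟨C, hC⟩ := exists_weightedSpectral_tight hf
  have hcompact := isCompact_setOfPred_finiteMeasure_mass_le_compl_isCompact_le (E := E d)
    (u := fun n : ℕ => C * (1 / ((n : ℝ≥0) + 1))) (K := fun n : ℕ => Metric.closedBall 0 (n : ℝ)) C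
    (by simpa using (tendsto_one_div_add_atTop_nhds_zero_nat (𝕜 := ℝ≥0)).const_mul C)
    (fun n => isCompact_closedBall _ _) (Or.inl inferInstance)
  let μ : ℕ → FiniteMeasure (E d) := fun n =>
    ⟨weightedSpectral f (1 / ((n : ℝ) + 1)) (by positivity),
      ⟨(hC _ _).1.trans_lt ENNReal.coe_lt_top⟩⟩
  have hmem : ∀ n, μ n ∈ {μ : FiniteMeasure (E d) | μ.mass ≤ C ∧
      ∀ n : ℕ, μ (Metric.closedBall 0 (n : ℝ))ᶜ ≤ C * (1 / ((n : ℝ≥0) + 1))} := by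
    intro n
    refine ⟨?_, fun k => ?_⟩
    · rw [← ENNReal.coe_le_coe, FiniteMeasure.ennreal_mass]
      exact (hC (1 / ((n : ℝ) + 1)) (by positivity)).1
    · rw [← ENNReal.coe_le_coe, FiniteMeasure.ennreal_coeFn_eq_coeFn_toMeasure]
      exact (hC (1 / ((n : ℝ) + 1)) (by positivity)).2 k
  -- Compactness is used along an ultrafilter, which avoids extracting a subsequence.
  obtain ⟨μ', -, hμ'⟩ := isCompact_iff_ultrafilter_le_nhds.1 hcompact
    ((hyperfilter ℕ).map μ) (by
      rw [Ultrafilter.coe_map, le_principal_iff, mem_map]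
      exact Eventually.of_forall hmem)
  have hlim : Tendsto μ (hyperfilter ℕ) (𝓝 μ') := hμ'
  rw [FiniteMeasure.tendsto_iff_forall_integral_rclike_tendsto ℂ] at hlim
  have hcontw : Continuous fun z : E d => (1 + ‖z‖ ^ 2) ^ (d + 2) := by fun_prop
  -- The weight is removed from the limit. The growth exponent `2 * (d + 2)` comes from `1 + ‖z‖² ≤
  -- (1 + ‖z‖)²` and the finiteness of `μ'`.
  refine ⟨(μ' : Measure (E d)).withDensity fun z => ENNReal.ofReal ((1 + ‖z‖ ^ 2) ^ (d + 2)),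
    ⟨2 * (d + 2), ?_⟩, fun φ => ?_⟩
  · rw [integrable_withDensity_iff_integrable_smul₀' (by fun_prop) (by simp)]
    refine Integrable.mono' (integrable_const (1 : ℝ)) (by fun_prop)
      (Eventually.of_forall fun z => ?_)
    rw [ENNReal.toReal_ofReal (by positivity), smul_eq_mul, Real.rpow_neg (by positivity),
      Real.rpow_natCast, Real.norm_eq_abs, abs_of_nonneg (by positivity),
      ← div_eq_mul_inv, div_le_one (by positivity), pow_mul]
    gcongr
    nlinarith [norm_nonneg z]
  · have hw : (fun z : E d => (((1 + ‖z‖ ^ 2) ^ (d + 2) : ℝ) : ℂ)).HasTemperateGrowth := by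
      fun_prop
    -- The weight times `φ` is still Schwartz, hence an admissible bounded continuous test function
    -- for weak convergence.
    have h1 := hlim (SchwartzMap.smulLeftCLM ℂ
      (fun z : E d => (((1 + ‖z‖ ^ 2) ^ (d + 2) : ℝ) : ℂ)) φ).toBoundedContinuousFunction
    simp only [SchwartzMap.toBoundedContinuousFunction_apply,
      SchwartzMap.smulLeftCLM_apply_apply hw, smul_eq_mul] at h1
    have h2 := (tendsto_integral_mul_smoothedSpectral f φ).mono_left
      (Nat.hyperfilter_le_atTop)
    have h3 := h1.congr fun n => integral_weightedSpectral hf _ _ φ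
    rw [← tendsto_nhds_unique h3 h2,
      integral_withDensity_eq_integral_toReal_smul (by fun_prop) (by simp)]
    congr 1
    funext z
    rw [ENNReal.toReal_ofReal (by positivity), Complex.real_smul]

lemma spectralMeasure_spec (f : Measure (E d)) [f.HasTemperateGrowth] (hf : IsNonnegDefinite f) :
    (spectralMeasure f).HasTemperateGrowth ∧ IsFourierTransform f (spectralMeasure f) := by
  have h := exists_isFourierTransform f hf
  rw [spectralMeasure, dif_pos h]
  exact h.choose_spec

/-! ### The atom at the origin and the asymptotic density of the covariance measure -/

lemma integral_gaussC_eq {f ν : Measure (E d)} (hν : IsFourierTransform f ν) (b : ℝ) (hb : 0 < b)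
    (u : E d) :
    ∫ z, gaussC b hb u z ∂ν =
      ((gaussMass d b * ∫ x, Real.exp (-(1 / (4 * b)) * ‖x + u‖ ^ 2) ∂f : ℝ) : ℂ) := by
  rw [hν, ← integral_const_mul, ← integral_complex_ofReal]
  simp_rw [fourierInt_gaussC]

/-- The modulation has modulus one, so the Gaussian averages of `f` are bounded uniformly in their
centre. -/
lemma gaussMass_mul_integral_le {f ν : Measure (E d)} (hν : IsFourierTransform f ν) (b : ℝ)
    (hb : 0 < b) (u : E d) :
    gaussMass d b * ∫ x, Real.exp (-(1 / (4 * b)) * ‖x + u‖ ^ 2) ∂f ≤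
      ∫ z, Real.exp (-b * ‖z‖ ^ 2) ∂ν := by
  refine (le_abs_self _).trans ?_
  rw [← Real.norm_eq_abs, ← Complex.norm_real, ← integral_gaussC_eq hν b hb u]
  refine (norm_integral_le_integral_norm _).trans_eq ?_
  simp_rw [norm_gaussC, gaussR_apply]

/-- The Gaussians shrink to the indicator of the origin, where the modulation equals `1`; hence the
limit does not depend on `y`. -/
lemma tendsto_integral_gaussC_atom (ν : Measure (E d)) [ν.HasTemperateGrowth] (y : E d) :
    Tendsto (fun n : ℕ => (∫ z, gaussC ((n : ℝ) + 1) (by positivity) y z ∂ν).re) atTop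
      (𝓝 (ν.real {0})) := by
  have h0 : ∫ z, Set.indicator {(0 : E d)} (fun _ => (1 : ℂ)) z ∂ν = ν.real {0} := by
    rw [integral_indicator_const _ (measurableSet_singleton 0)]
    simp
  rw [← Complex.ofReal_re (ν.real {0}), ← h0]
  refine (Complex.continuous_re.tendsto _).comp ?_
  refine tendsto_integral_of_dominated_convergence (fun z => gaussR d 1 one_pos z)
    (fun n => (gaussC _ _ y).continuous.aestronglyMeasurable) (gaussR d 1 one_pos).integrable
    (fun n => ?_) ?_
  · refine Eventually.of_forall fun z => ?_
    rw [norm_gaussC, gaussR_apply, gaussR_apply, Real.exp_le_exp]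
    have : 0 ≤ (n : ℝ) * ‖z‖ ^ 2 := by positivity
    linarith
  · refine Eventually.of_forall fun z => ?_
    by_cases hz : z = 0
    · simp [hz, gaussC_apply]
    · rw [Set.indicator_of_notMem (by simpa using hz), tendsto_zero_iff_norm_tendsto_zero]
      simp_rw [norm_gaussC, gaussR_apply]
      refine Real.tendsto_exp_atBot.comp ?_
      have hz' : 0 < ‖z‖ ^ 2 := by positivity
      have h1 : Tendsto (fun n : ℕ => ((n : ℝ) + 1) * ‖z‖ ^ 2) atTop atTop :=
        (tendsto_atTop_add_const_right _ _ tendsto_natCast_atTop_atTop).atTop_mul_const hz'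
      refine (tendsto_neg_atTop_atBot.comp h1).congr fun n => ?_
      rw [Function.comp_apply, neg_mul]

lemma tendsto_integral_gauss_atom (ν : Measure (E d)) [ν.HasTemperateGrowth] :
    Tendsto (fun n : ℕ => ∫ z, Real.exp (-((n : ℝ) + 1) * ‖z‖ ^ 2) ∂ν) atTop (𝓝 (ν.real {0})) := by
  refine (tendsto_integral_gaussC_atom ν 0).congr fun n => ?_
  rw [← Complex.ofReal_re (∫ z, Real.exp (-((n : ℝ) + 1) * ‖z‖ ^ 2) ∂ν), ← integral_complex_ofReal]
  simp_rw [gaussC_apply]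
  simp

lemma gaussMass_mul_gaussMass (b : ℝ) (hb : 0 < b) :
    gaussMass d b * gaussMass d (1 / (4 * b)) = (2 * Real.pi) ^ d := by
  have hpi := Real.pi_pos
  rw [gaussMass, gaussMass, ← Real.mul_rpow (by positivity) (by positivity)]
  have : Real.pi / b * (Real.pi / (1 / (4 * b))) = (2 * Real.pi) ^ 2 := by
    field_simp
    ring
  rw [this, ← Real.rpow_natCast, ← Real.rpow_mul (by positivity), ← Real.rpow_natCast]
  congr 1
  push_cast
  ring

/-! ### Decay of correlations along suitable translations -/

/-- The spatial covariance `⟨φ, ψ * f⟩`. -/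
noncomputable def pairing (f : Measure (E d)) (φ ψ : 𝓢(E d, ℝ)) : ℝ :=
  ∫ x, φ x * (∫ y, ψ (x - y) ∂f)

lemma enorm_pairing_translate_le (f : Measure (E d)) (φ ψ : 𝓢(E d, ℝ)) (y : E d) :
    ‖pairing f φ (SchwartzMap.compSubConstCLM ℝ y ψ)‖ₑ ≤
      ∫⁻ x, ‖φ x‖ₑ * ∫⁻ z, ‖ψ (x - z - y)‖ₑ ∂f := by
  refine (enorm_integral_le_lintegral_enorm _).trans (lintegral_mono fun x => ?_)
  rw [enorm_mul]
  gcongr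
  exact enorm_integral_le_lintegral_enorm _

lemma measurable_lintegral_translate (f : Measure (E d)) [SFinite f] (φ ψ : 𝓢(E d, ℝ)) :
    Measurable fun y => ∫⁻ x, ‖φ x‖ₑ * ∫⁻ z, ‖ψ (x - z - y)‖ₑ ∂f := by
  have hφ := φ.continuous.measurable
  have hψ := ψ.continuous.measurable
  have h1 : Measurable fun p : (E d × E d) × E d => ‖ψ (p.1.2 - p.2 - p.1.1)‖ₑ := by fun_prop
  have h2 : Measurable fun p : E d × E d => ∫⁻ z, ‖ψ (p.2 - z - p.1)‖ₑ ∂f := h1.lintegral_prod_right'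
  have h3 : Measurable fun p : E d × E d => ‖φ p.2‖ₑ * ∫⁻ z, ‖ψ (p.2 - z - p.1)‖ₑ ∂f := by fun_prop
  exact h3.lintegral_prod_right'

lemma lintegral_gauss_translate_le {f ν : Measure (E d)} [f.HasTemperateGrowth]
    (hν : IsFourierTransform f ν) (b : ℝ) (hb : 0 < b) (u : E d) :
    ∫⁻ z, ENNReal.ofReal (gaussMass d b * Real.exp (-(1 / (4 * b)) * ‖u - z‖ ^ 2)) ∂f ≤
      ENNReal.ofReal (∫ z, Real.exp (-b * ‖z‖ ^ 2) ∂ν) := by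
  have hm := gaussMass_pos d hb
  have hb' : 0 < 1 / (4 * b) := by positivity
  have h_integrable : Integrable (fun z => gaussMass d b * Real.exp (-(1 / (4 * b)) * ‖u - z‖ ^ 2)) f := by
    refine Integrable.const_mul ?_ _
    refine ((SchwartzMap.compSubConstCLM ℝ u (gaussR d _ hb')).integrable (μ := f)).congr
      (Eventually.of_forall fun z => ?_)
    simp [norm_sub_rev]
  rw [← ofReal_integral_eq_lintegral_ofReal h_integrable (Eventually.of_forall fun z => by positivity),
    integral_const_mul]
  refine ENNReal.ofReal_le_ofReal ?_
  have h := gaussMass_mul_integral_le hν b hb (-u)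
  simp_rw [← sub_eq_add_neg, norm_sub_rev _ u] at h
  exact h

/-- Tonelli and the substitution `w = x - z - y` move the kernel `g` onto `f`, where its integral is
at most `N` whatever the centre; the integrals of `φ` and `ψ` then factor out. -/
lemma lintegral_convolution_le {f : Measure (E d)} [SFinite f] {g φ ψ : E d → ℝ≥0∞}
    (hg : Measurable g) (hφ : Measurable φ) (hψ : Measurable ψ) {N : ℝ≥0∞}
    (hN : ∀ u, ∫⁻ z, g (u - z) ∂f ≤ N) :
    ∫⁻ y, g y * (∫⁻ x, φ x * ∫⁻ z, ψ (x - z - y) ∂f) ≤ (∫⁻ x, φ x) * (∫⁻ x, ψ x) * N := by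
  have m1 : ∀ x, Measurable fun p : E d × E d => ψ (x - p.2 - p.1) := fun x => by fun_prop
  have m2 : ∀ x, Measurable fun y : E d => ∫⁻ z, ψ (x - z - y) ∂f :=
    fun x => (m1 x).lintegral_prod_right'
  have m3 : Measurable fun p : (E d × E d) × E d => ψ (p.1.2 - p.2 - p.1.1) := by fun_prop
  have m4 : Measurable fun p : E d × E d => ∫⁻ z, ψ (p.2 - z - p.1) ∂f :=
    m3.lintegral_prod_right'
  have hin : ∀ x, ∫⁻ y, g y * ∫⁻ z, ψ (x - z - y) ∂f ≤ (∫⁻ w, ψ w) * N := by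
    intro x
    calc ∫⁻ y, g y * ∫⁻ z, ψ (x - z - y) ∂f
        = ∫⁻ y, ∫⁻ z, g y * ψ (x - z - y) ∂f := by
          refine lintegral_congr fun y => ?_
          rw [lintegral_const_mul _ (by fun_prop)]
      _ = ∫⁻ z, ∫⁻ y, g y * ψ (x - z - y) ∂volume ∂f :=
          lintegral_lintegral_swap (by fun_prop)
      _ = ∫⁻ z, ∫⁻ w, g (x - w - z) * ψ w ∂volume ∂f := by
          refine lintegral_congr fun z => ?_
          rw [← lintegral_sub_left_eq_self _ (x - z)]
          refine lintegral_congr fun w => ?_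
          rw [sub_sub_cancel, sub_right_comm]
      _ = ∫⁻ w, ∫⁻ z, g (x - w - z) * ψ w ∂f := lintegral_lintegral_swap (by fun_prop)
      _ ≤ ∫⁻ w, ψ w * N := by
          refine lintegral_mono fun w => ?_
          dsimp only
          rw [lintegral_mul_const _ (by fun_prop), mul_comm]
          exact mul_le_mul_right (hN (x - w)) _
      _ = _ := lintegral_mul_const _ (by fun_prop)
  calc ∫⁻ y, g y * ∫⁻ x, φ x * ∫⁻ z, ψ (x - z - y) ∂f
      = ∫⁻ y, ∫⁻ x, g y * (φ x * ∫⁻ z, ψ (x - z - y) ∂f) := by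
        refine lintegral_congr fun y => ?_
        have : Measurable fun x : E d => ∫⁻ z, ψ (x - z - y) ∂f :=
          m4.comp (measurable_const.prodMk measurable_id)
        rw [lintegral_const_mul _ (by fun_prop)]
    _ = ∫⁻ x, ∫⁻ y, g y * (φ x * ∫⁻ z, ψ (x - z - y) ∂f) :=
        lintegral_lintegral_swap (Measurable.aemeasurable
          ((hg.comp measurable_fst).mul ((hφ.comp measurable_snd).mul m4)))
    _ ≤ ∫⁻ x, φ x * ((∫⁻ w, ψ w) * N) := by
        refine lintegral_mono fun x => ?_
        have h1 : ∀ y, g y * (φ x * ∫⁻ z, ψ (x - z - y) ∂f) =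
            φ x * (g y * ∫⁻ z, ψ (x - z - y) ∂f) := fun y => by ring
        simp_rw [h1]
        have hm : Measurable fun y => g y * ∫⁻ z, ψ (x - z - y) ∂f := hg.mul (m2 x)
        rw [lintegral_const_mul _ hm]
        exact mul_le_mul_right (hin x) _
    _ = _ := by rw [lintegral_mul_const _ (by fun_prop), mul_assoc]

/-- If the spectral measure does not charge the origin, then finitely many spatial covariances can
be made small simultaneously by a translation. -/
theorem exists_translate_pairing_le {f ν : Measure (E d)} [f.HasTemperateGrowth]
    [ν.HasTemperateGrowth] (hν : IsFourierTransform f ν) (h0 : ν {0} = 0)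
    {κ : Type*} [Fintype κ] (φ ψ : κ → 𝓢(E d, ℝ)) {δ : ℝ} (hδ : 0 < δ) :
    ∃ y : E d, ∀ k, |pairing f (φ k) (SchwartzMap.compSubConstCLM ℝ y (ψ k))| ≤ δ := by
  have := sigmaFinite_of_hasTemperateGrowth f
  by_contra! hcon
  set S : ℝ≥0∞ := ∑ k, (∫⁻ x, ‖φ k x‖ₑ) * (∫⁻ x, ‖ψ k x‖ₑ) with hS
  have hSfin : S ≠ ∞ := by
    refine (ENNReal.sum_lt_top.2 fun k _ => ?_).ne
    exact ENNReal.mul_lt_top (φ k).integrable.2 (ψ k).integrable.2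
  -- If some covariance exceeds `δ` at every `y`, their sum does too. Integrating over `y` against a
  -- Gaussian of total mass `(2π) ^ d` bounds `(2π) ^ d * δ` by a multiple of an integral tending to
  -- `ν {0} = 0`.
  have key : ∀ n : ℕ, ENNReal.ofReal ((2 * Real.pi) ^ d * δ) ≤
      S * ENNReal.ofReal (∫ z, Real.exp (-((n : ℝ) + 1) * ‖z‖ ^ 2) ∂ν) := by
    intro n
    have hb : (0 : ℝ) < (n : ℝ) + 1 := by positivity
    have hb' : 0 < 1 / (4 * ((n : ℝ) + 1)) := by positivity
    have hm := gaussMass_pos d hb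
    calc ENNReal.ofReal ((2 * Real.pi) ^ d * δ)
        = ∫⁻ y : E d, ENNReal.ofReal (gaussMass d ((n : ℝ) + 1) *
            Real.exp (-(1 / (4 * ((n : ℝ) + 1))) * ‖y‖ ^ 2)) * ENNReal.ofReal δ := by
          have h_integrable : Integrable (fun y : E d => gaussMass d ((n : ℝ) + 1) *
              Real.exp (-(1 / (4 * ((n : ℝ) + 1))) * ‖y‖ ^ 2)) volume :=
            (gaussR d _ hb').integrable.const_mul _
          rw [lintegral_mul_const _ (by fun_prop), ← ofReal_integral_eq_lintegral_ofReal h_integrable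
            (Eventually.of_forall fun z => by positivity),
            integral_const_mul, ← ENNReal.ofReal_mul (by positivity)]
          have h1 := integral_rexp_gauss (d := d) hb' 0 0
          simp only [zero_mul, add_zero] at h1
          rw [h1, ← gaussMass_mul_gaussMass _ hb]
          simp
      _ ≤ ∫⁻ y : E d, ∑ k, ENNReal.ofReal (gaussMass d ((n : ℝ) + 1) *
            Real.exp (-(1 / (4 * ((n : ℝ) + 1))) * ‖y‖ ^ 2)) *
              (∫⁻ x, ‖φ k x‖ₑ * ∫⁻ z, ‖ψ k (x - z - y)‖ₑ ∂f) := by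
          refine lintegral_mono fun y => ?_
          obtain ⟨k, hk⟩ := hcon y
          rw [← Finset.mul_sum]
          refine mul_le_mul_right ?_ _
          calc ENNReal.ofReal δ
              ≤ ‖pairing f (φ k) (SchwartzMap.compSubConstCLM ℝ y (ψ k))‖ₑ := by
                rw [← ofReal_norm]
                exact ENNReal.ofReal_le_ofReal hk.le
            _ ≤ _ := enorm_pairing_translate_le f (φ k) (ψ k) y
            _ ≤ _ := Finset.single_le_sum
                (f := fun k => ∫⁻ x, ‖φ k x‖ₑ * ∫⁻ z, ‖ψ k (x - z - y)‖ₑ ∂f)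
                (fun _ _ => bot_le) (Finset.mem_univ k)
      _ = ∑ k, ∫⁻ y : E d, ENNReal.ofReal (gaussMass d ((n : ℝ) + 1) *
            Real.exp (-(1 / (4 * ((n : ℝ) + 1))) * ‖y‖ ^ 2)) *
              (∫⁻ x, ‖φ k x‖ₑ * ∫⁻ z, ‖ψ k (x - z - y)‖ₑ ∂f) := by
          refine lintegral_finsetSum _ fun k _ => ?_
          have := measurable_lintegral_translate f (φ k) (ψ k)
          fun_prop
      _ ≤ ∑ k, (∫⁻ x, ‖φ k x‖ₑ) * (∫⁻ x, ‖ψ k x‖ₑ) *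
            ENNReal.ofReal (∫ z, Real.exp (-((n : ℝ) + 1) * ‖z‖ ^ 2) ∂ν) :=
          Finset.sum_le_sum fun k _ => lintegral_convolution_le (by fun_prop)
            (φ k).continuous.measurable.enorm (ψ k).continuous.measurable.enorm
            (lintegral_gauss_translate_le hν _ hb)
      _ = _ := by rw [Finset.sum_mul]
  have hlim : Tendsto (fun n : ℕ => S * ENNReal.ofReal
      (∫ z, Real.exp (-((n : ℝ) + 1) * ‖z‖ ^ 2) ∂ν)) atTop (𝓝 (S * ENNReal.ofReal 0)) := by
    refine ENNReal.Tendsto.const_mul (ENNReal.tendsto_ofReal ?_) (Or.inr hSfin)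
    have := tendsto_integral_gauss_atom ν
    rwa [measureReal_def, h0, ENNReal.toReal_zero] at this
  have hle := ge_of_tendsto' hlim key
  have hpos : 0 < (2 * Real.pi) ^ d * δ := by
    have := Real.pi_pos
    positivity
  simp only [ENNReal.ofReal_zero, mul_zero, nonpos_iff_eq_zero, ENNReal.ofReal_eq_zero] at hle
  linarith

/-! ### Gaussian families and their laws -/

/-- Characteristic functions determine the finite-dimensional marginals, and these determine the
measure. Allowing total mass other than one lets it apply to the restriction of a law to an event.
-/
lemma ext_of_integral_cexp_sum {ι : Type*} {μ ν : Measure (ι → ℝ)} [IsFiniteMeasure μ]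
    [IsFiniteMeasure ν]
    (h : ∀ (s : Finset ι) (c : s → ℝ), ∫ x, Complex.exp (((∑ i : s, c i * x i : ℝ) : ℂ) * I) ∂μ =
      ∫ x, Complex.exp (((∑ i : s, c i * x i : ℝ) : ℂ) * I) ∂ν) : μ = ν := by
  classical
  have key : ∀ s : Finset ι, μ.map s.restrict = ν.map s.restrict := by
    intro s
    refine Measure.ext_of_charFunDual (funext fun L => ?_)
    have hL : ∀ v : s → ℝ, L v = ∑ i, L (Pi.single i 1) * v i := by
      intro v
      conv_lhs => rw [pi_eq_sum_univ' v]
      rw [map_sum]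
      refine Finset.sum_congr rfl fun i _ => ?_
      rw [map_smul, smul_eq_mul, mul_comm]
    rw [charFunDual_apply, charFunDual_apply,
      integral_map (Finset.measurable_restrict s).aemeasurable (by fun_prop),
      integral_map (Finset.measurable_restrict s).aemeasurable (by fun_prop)]
    have hL' : ∀ x : ι → ℝ, L (s.restrict x) = ∑ i : s, L (Pi.single i 1) * x i := fun x => hL _
    simp_rw [hL']
    exact h s fun i => L (Pi.single i 1)
  exact IsProjectiveLimit.unique (P := fun s => ν.map s.restrict) (fun s => key s) (fun s => rfl)

lemma integral_cexp_of_hasGaussianLaw {Ω : Type*} [MeasurableSpace Ω] {P : Measure Ω} {X : Ω → ℝ}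
    (hX : HasGaussianLaw X P) (h0 : ∫ ω, X ω ∂P = 0) :
    ∫ ω, Complex.exp ((X ω : ℂ) * I) ∂P = (Real.exp (-Var[X; P] / 2) : ℂ) := by
  have h := hX.charFun_map_eq 1
  rw [charFun_apply_real, integral_map hX.aemeasurable (by fun_prop)] at h
  simp only [Complex.ofReal_one, one_mul, RCLike.inner_apply, conj_trivial, mul_one] at h
  rw [h, h0]
  push_cast
  congr 1
  ring

section Noise

variable {Ω : Type*} [MeasurableSpace Ω] {f : Measure (E d)} {W : Idx d → Ω → ℝ} {P : Measure Ω}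

lemma IsNoise.hasGaussianLaw_sum (hW : IsNoise f W P) {κ : Type*} [Fintype κ] (c : κ → ℝ)
    (i : κ → Idx d) : HasGaussianLaw (fun ω => ∑ k, c k * W (i k) ω) P := by
  have h := (hW.gaussian.comp_right i).hasGaussianLaw Finset.univ
  let L : (↥(Finset.univ : Finset κ) → ℝ) →L[ℝ] ℝ :=
    ∑ k, c k • ContinuousLinearMap.proj (R := ℝ) (φ := fun _ : ↥(Finset.univ : Finset κ) => ℝ)
      ⟨k, Finset.mem_univ k⟩
  have h2 := h.map_fun L
  have h3 : (fun ω => ∑ k, c k * W (i k) ω) =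
      fun ω => L ((Finset.univ : Finset κ).restrict fun k => (W ∘ i) k ω) := by
    funext ω
    simp [L, Finset.restrict_def]
  rw [h3]
  exact h2

lemma IsNoise.memLp (hW : IsNoise f W P) (i : Idx d) : MemLp (W i) 2 P :=
  (hW.gaussian.hasGaussianLaw_eval i).memLp_two

lemma IsNoise.covariance (hW : IsNoise f W P) (i j : Idx d) :
    cov[W i, W j; P] = ((min i.1 j.1 : ℝ≥0) : ℝ) * pairing f i.2 j.2 :=
  hW.covariance_eq i.1 j.1 i.2 j.2

lemma IsNoise.integral_sum (hW : IsNoise f W P) {κ : Type*} [Fintype κ] (c : κ → ℝ)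
    (i : κ → Idx d) : ∫ ω, ∑ k, c k * W (i k) ω ∂P = 0 := by
  have := hW.gaussian.isProbabilityMeasure
  rw [integral_finsetSum _ fun k _ => ((hW.memLp (i k)).integrable one_le_two).const_mul _]
  simp [integral_const_mul, hW.centered]

lemma IsNoise.covariance_sum (hW : IsNoise f W P) {κ : Type*} [Fintype κ] (c : κ → ℝ)
    (i j : κ → Idx d) :
    cov[fun ω => ∑ k, c k * W (i k) ω, fun ω => ∑ k, c k * W (j k) ω; P] =
      ∑ k, ∑ l, c k * c l * (((min (i k).1 (j l).1 : ℝ≥0) : ℝ) *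
        pairing f (i k).2 (j l).2) := by
  have := hW.gaussian.isProbabilityMeasure
  rw [covariance_fun_sum_fun_sum (fun k => (hW.memLp (i k)).const_mul _)
    fun k => (hW.memLp (j k)).const_mul _]
  simp_rw [covariance_const_mul_left, covariance_const_mul_right, hW.covariance, mul_assoc]

lemma measurable_shiftNoise (y : E d) : Measurable (shiftNoise y) :=
  measurable_pi_lambda _ fun _ => measurable_pi_apply _

lemma shiftNoise_shiftNoise (x y : E d) (η : Idx d → ℝ) :
    shiftNoise x (shiftNoise y η) = shiftNoise (x + y) η := by
  funext i
  simp [shiftNoise]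

lemma pairing_translate (f : Measure (E d)) (φ ψ : 𝓢(E d, ℝ)) (y : E d) :
    pairing f (SchwartzMap.compSubConstCLM ℝ y φ) (SchwartzMap.compSubConstCLM ℝ y ψ) =
      pairing f φ ψ := by
  unfold pairing
  rw [← integral_sub_right_eq_self (fun x => φ x * ∫ z, ψ (x - z) ∂f) y]
  simp_rw [SchwartzMap.compSubConstCLM_apply, sub_right_comm _ _ y]

lemma IsNoise.measurable_joint (hW : IsNoise f W P) : Measurable fun ω i => W i ω :=
  measurable_pi_lambda _ hW.measurable

/-- The coordinate process under the law of a noise is a noise. -/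
lemma IsNoise.canonical (hW : IsNoise f W P) :
    IsNoise f (fun i (η : Idx d → ℝ) => η i) (P.map fun ω i => W i ω) where
  measurable i := measurable_pi_apply i
  gaussian := by
    refine ⟨fun s => ⟨?_⟩⟩
    have h := (hW.gaussian.hasGaussianLaw s).isGaussian_map
    rwa [Measure.map_map (by fun_prop) hW.measurable_joint]
  centered i := by
    rw [integral_map hW.measurable_joint.aemeasurable
      (measurable_pi_apply i).aestronglyMeasurable]
    exact hW.centered i
  covariance_eq s t φ ψ := by
    rw [covariance_map (measurable_pi_apply _).aestronglyMeasurable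
      (measurable_pi_apply _).aestronglyMeasurable hW.measurable_joint.aemeasurable]
    exact hW.covariance_eq s t φ ψ

end Noise

/-- The law of the noise is invariant under spatial shifts. -/
lemma IsNoise.measurePreserving_shiftNoise {f : Measure (E d)} {μ : Measure (Idx d → ℝ)}
    (hμ : IsNoise f (fun i η => η i) μ) (y : E d) : MeasurePreserving (shiftNoise y) μ μ := by
  have := hμ.gaussian.isProbabilityMeasure
  have hm := measurable_shiftNoise y
  refine ⟨hm, ?_⟩
  have := Measure.isProbabilityMeasure_map (μ := μ) hm.aemeasurable
  refine ext_of_integral_cexp_sum fun s c => ?_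
  rw [integral_map hm.aemeasurable (Measurable.aestronglyMeasurable (by fun_prop))]
  let j : s → Idx d := fun k => ((k : Idx d).1, SchwartzMap.compSubConstCLM ℝ y (k : Idx d).2)
  have h1 := integral_cexp_of_hasGaussianLaw (hμ.hasGaussianLaw_sum c fun k : s => (k : Idx d))
    (hμ.integral_sum c _)
  have h2 := integral_cexp_of_hasGaussianLaw (hμ.hasGaussianLaw_sum c j) (hμ.integral_sum c _)
  have hvar : Var[fun η : Idx d → ℝ => ∑ k, c k * η (j k); μ] =
      Var[fun η : Idx d → ℝ => ∑ k : s, c k * η k; μ] := by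
    rw [← covariance_self (hμ.hasGaussianLaw_sum c j).aemeasurable,
      ← covariance_self (hμ.hasGaussianLaw_sum c fun k : s => (k : Idx d)).aemeasurable,
      hμ.covariance_sum, hμ.covariance_sum]
    simp only [j, pairing_translate]
  rw [hvar] at h2
  exact h2.trans h1.symm

lemma measurable_shiftField_pi {G : (Idx d → ℝ) → ℝ} (hG : Measurable G) :
    Measurable fun (η : Idx d → ℝ) (x : E d) => G (shiftNoise x η) :=
  measurable_pi_lambda _ fun x => hG.comp (measurable_shiftNoise x)

theorem isStationaryField_shiftField {Ω : Type*} [MeasurableSpace Ω] {f : Measure (E d)}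
    {W : Idx d → Ω → ℝ} {P : Measure Ω} (hW : IsNoise f W P) {G : (Idx d → ℝ) → ℝ}
    (hG : Measurable G) : IsStationaryField P (shiftField W G) := by
  intro y
  have hΨ := measurable_shiftField_pi hG
  have hJ := hW.measurable_joint
  have hs := hW.canonical.measurePreserving_shiftNoise y
  have h1 : (fun ω x => shiftField W G (x + y) ω) =
      (fun (η : Idx d → ℝ) (x : E d) => G (shiftNoise x η)) ∘ shiftNoise y ∘ fun ω i => W i ω := by
    funext ω x
    simp [shiftField, shiftNoise_shiftNoise]
  have h2 : (fun ω x => shiftField W G x ω) =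
      (fun (η : Idx d → ℝ) (x : E d) => G (shiftNoise x η)) ∘ fun ω i => W i ω := rfl
  refine ⟨?_, ?_, ?_⟩
  · rw [h1]
    exact (hΨ.comp (hs.measurable.comp hJ)).aemeasurable
  · rw [h2]
    exact (hΨ.comp hJ).aemeasurable
  · rw [h1, h2, ← Measure.map_map hΨ (hs.measurable.comp hJ), ← Measure.map_map hs.measurable hJ,
      hs.map_eq, Measure.map_map hΨ hJ]

/-! ### Ergodicity when the spectral measure does not charge the origin -/

/-- Jensen, in the form of nonnegativity of the variance of `‖S‖`. -/
lemma sq_norm_setIntegral_le {Ω : Type*} [MeasurableSpace Ω] {μ : Measure Ω}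
    [IsProbabilityMeasure μ] {S : Ω → ℂ} (hS : MemLp S 2 μ) (B : Set Ω) :
    ‖∫ ω in B, S ω ∂μ‖ ^ 2 ≤ ∫ ω, ‖S ω‖ ^ 2 ∂μ := by
  have h_integrable : Integrable S μ := hS.integrable one_le_two
  have h1 : ‖∫ ω in B, S ω ∂μ‖ ≤ ∫ ω, ‖S ω‖ ∂μ :=
    (norm_integral_le_integral_norm _).trans
      (setIntegral_le_integral h_integrable.norm (Eventually.of_forall fun _ => norm_nonneg _))
  have h2 := variance_nonneg (fun ω => ‖S ω‖) μ
  rw [variance_eq_sub hS.norm] at h2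
  have h3 : ‖∫ ω in B, S ω ∂μ‖ ^ 2 ≤ (∫ ω, ‖S ω‖ ∂μ) ^ 2 := by gcongr
  simp only [Pi.pow_apply] at h2
  linarith

lemma integral_norm_sq_sum {Ω : Type*} [MeasurableSpace Ω] {μ : Measure Ω}
    {κ : Type*} (s : Finset κ) {Z : κ → Ω → ℂ} (hZ : ∀ k, MemLp (Z k) 2 μ) :
    ((∫ ω, ‖∑ k ∈ s, Z k ω‖ ^ 2 ∂μ : ℝ) : ℂ) =
      ∑ k ∈ s, ∑ l ∈ s, ∫ ω, Z k ω * (starRingEnd ℂ) (Z l ω) ∂μ := by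
  have h_integrable : ∀ k l, Integrable (fun ω => Z k ω * (starRingEnd ℂ) (Z l ω)) μ :=
    fun k l => (hZ k).integrable_mul (hZ l).star
  rw [← integral_complex_ofReal]
  simp_rw [Complex.ofReal_pow, ← Complex.mul_conj', map_sum, Finset.sum_mul_sum]
  rw [integral_finsetSum _ fun k _ => integrable_finsetSum _ fun l _ => h_integrable k l]
  refine Finset.sum_congr rfl fun k _ => ?_
  rw [integral_finsetSum _ fun l _ => h_integrable k l]

section

variable {f : Measure (E d)} {μ : Measure (Idx d → ℝ)} {κ : Type*} [Fintype κ]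

/-- The Wiener integral of a linear combination of translated test functions. -/
noncomputable def linNoise (c : κ → ℝ) (i : κ → Idx d) (y : E d) (η : Idx d → ℝ) : ℝ :=
  ∑ k, c k * shiftNoise y η (i k)

lemma measurable_linNoise (c : κ → ℝ) (i : κ → Idx d) (y : E d) : Measurable (linNoise c i y) := by
  unfold linNoise shiftNoise
  fun_prop

lemma IsNoise.hasGaussianLaw_linNoise (hμ : IsNoise f (fun i η => η i) μ) (c : κ → ℝ)
    (i : κ → Idx d) (y : E d) : HasGaussianLaw (linNoise c i y) μ :=
  hμ.hasGaussianLaw_sum c fun k => ((i k).1, SchwartzMap.compSubConstCLM ℝ y (i k).2)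

lemma IsNoise.integral_linNoise (hμ : IsNoise f (fun i η => η i) μ) (c : κ → ℝ)
    (i : κ → Idx d) (y : E d) : ∫ η, linNoise c i y η ∂μ = 0 :=
  hμ.integral_sum c fun k => ((i k).1, SchwartzMap.compSubConstCLM ℝ y (i k).2)

lemma IsNoise.variance_linNoise (hμ : IsNoise f (fun i η => η i) μ) (c : κ → ℝ)
    (i : κ → Idx d) (y : E d) : Var[linNoise c i y; μ] = Var[linNoise c i 0; μ] := by
  rw [← covariance_self (hμ.hasGaussianLaw_linNoise c i y).aemeasurable,
    ← covariance_self (hμ.hasGaussianLaw_linNoise c i 0).aemeasurable]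
  have h := fun y => hμ.covariance_sum c
    (fun k => ((i k).1, SchwartzMap.compSubConstCLM ℝ y (i k).2))
    (fun k => ((i k).1, SchwartzMap.compSubConstCLM ℝ y (i k).2))
  simp only [pairing_translate] at h
  exact (h y).trans (h 0).symm

lemma IsNoise.hasGaussianLaw_linNoise_sub (hμ : IsNoise f (fun i η => η i) μ) (c : κ → ℝ)
    (i : κ → Idx d) (x y : E d) :
    HasGaussianLaw (fun η => linNoise c i x η - linNoise c i y η) μ := by
  have h := hμ.hasGaussianLaw_sum (Sum.elim c fun k => -c k)
    (Sum.elim (fun k => ((i k).1, SchwartzMap.compSubConstCLM ℝ x (i k).2))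
      fun k => ((i k).1, SchwartzMap.compSubConstCLM ℝ y (i k).2))
  have h2 : (fun η => linNoise c i x η - linNoise c i y η) = fun η : Idx d → ℝ =>
      ∑ k, (Sum.elim c fun k => -c k) k *
        η ((Sum.elim (fun k => ((i k).1, SchwartzMap.compSubConstCLM ℝ x (i k).2))
      fun k => ((i k).1, SchwartzMap.compSubConstCLM ℝ y (i k).2)) k) := by
    funext η
    simp [linNoise, shiftNoise, Fintype.sum_sum_type, sub_eq_add_neg]
  rw [h2]
  exact h

lemma IsNoise.integral_cexp_linNoise (hμ : IsNoise f (fun i η => η i) μ) (c : κ → ℝ)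
    (i : κ → Idx d) (y : E d) :
    ∫ η, Complex.exp ((linNoise c i y η : ℂ) * I) ∂μ =
      (Real.exp (-Var[linNoise c i 0; μ] / 2) : ℂ) := by
  rw [integral_cexp_of_hasGaussianLaw (hμ.hasGaussianLaw_linNoise c i y)
    (hμ.integral_linNoise c i y), hμ.variance_linNoise]

lemma IsNoise.integral_cexp_linNoise_sub (hμ : IsNoise f (fun i η => η i) μ) (c : κ → ℝ)
    (i : κ → Idx d) (x y : E d) :
    ∫ η, Complex.exp (((linNoise c i x η - linNoise c i y η : ℝ) : ℂ) * I) ∂μ =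
      (Real.exp (-Var[linNoise c i 0; μ] + cov[linNoise c i x, linNoise c i y; μ]) : ℂ) := by
  have := hμ.gaussian.isProbabilityMeasure
  have hx := (hμ.hasGaussianLaw_linNoise c i x).memLp_two
  have hy := (hμ.hasGaussianLaw_linNoise c i y).memLp_two
  rw [integral_cexp_of_hasGaussianLaw (hμ.hasGaussianLaw_linNoise_sub c i x y)]
  · rw [variance_fun_sub hx hy, hμ.variance_linNoise c i x, hμ.variance_linNoise c i y]
    congr 2
    ring
  · rw [integral_sub (hx.integrable one_le_two) (hy.integrable one_le_two),
      hμ.integral_linNoise, hμ.integral_linNoise, sub_zero]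

/-- The translations are chosen one after another: against finitely many earlier ones only finitely
many spatial covariances must be small, and one `y` achieves this. -/
lemma IsNoise.exists_seq_covariance_le {ν : Measure (E d)} [f.HasTemperateGrowth]
    [ν.HasTemperateGrowth] (hν : IsFourierTransform f ν) (h0 : ν {0} = 0)
    (hμ : IsNoise f (fun i η => η i) μ) (c : κ → ℝ) (i : κ → Idx d) {δ : ℝ} (hδ : 0 < δ) :
    ∃ y : ℕ → E d, ∀ m n, m ≠ n → |cov[linNoise c i (y m), linNoise c i (y n); μ]| ≤ δ := by
  let r : E d → E d → Prop := fun x y => |cov[linNoise c i x, linNoise c i y; μ]| ≤ δ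
  have : Std.Symm r := ⟨fun x y h => by
    change |_| ≤ δ
    rw [covariance_comm]
    exact h⟩
  have hex : ∀ s : Finset (E d), (∀ x ∈ s, True) → ∃ y, True ∧ ∀ x ∈ s, r x y := by
    intro s _
    -- `M` bounds the total weight of the spatial covariances; dividing by `M + 1` avoids the case
    -- `M = 0`.
    set M : ℝ := ∑ k, ∑ l, |c k * c l| * ((min (i k).1 (i l).1 : ℝ≥0) : ℝ) with hM
    have hM0 : 0 ≤ M := by positivity
    obtain ⟨y, hy⟩ := exists_translate_pairing_le hν h0
      (κ := s × κ × κ) (fun q => SchwartzMap.compSubConstCLM ℝ (q.1 : E d) (i q.2.1).2)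
      (fun q => (i q.2.2).2) (δ := δ / (M + 1)) (by positivity)
    refine ⟨y, trivial, fun x hx => ?_⟩
    have h := hμ.covariance_sum c (fun k => ((i k).1, SchwartzMap.compSubConstCLM ℝ x (i k).2))
      (fun k => ((i k).1, SchwartzMap.compSubConstCLM ℝ y (i k).2))
    change |cov[fun η : Idx d → ℝ => ∑ k, c k *
        η ((i k).1, SchwartzMap.compSubConstCLM ℝ x (i k).2), fun η : Idx d → ℝ => ∑ k, c k *
        η ((i k).1, SchwartzMap.compSubConstCLM ℝ y (i k).2); μ]| ≤ δ
    dsimp only at h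
    rw [h]
    calc _ ≤ ∑ k, ∑ l, |c k * c l| * ((min (i k).1 (i l).1 : ℝ≥0) : ℝ) * (δ / (M + 1)) := by
          refine (Finset.abs_sum_le_sum_abs _ _).trans (Finset.sum_le_sum fun k _ => ?_)
          refine (Finset.abs_sum_le_sum_abs _ _).trans (Finset.sum_le_sum fun l _ => ?_)
          rw [abs_mul, abs_mul ((min (i k).1 (i l).1 : ℝ≥0) : ℝ), NNReal.abs_eq, ← mul_assoc]
          gcongr
          exact hy (⟨x, hx⟩, k, l)
      _ = M * (δ / (M + 1)) := by simp_rw [hM, Finset.sum_mul]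
      _ ≤ δ := by
          rw [mul_div_assoc', div_le_iff₀ (by positivity)]
          nlinarith
  obtain ⟨y, -, hy⟩ := exists_seq_of_forall_finset_exists' (fun _ => True) r hex
  exact ⟨y, fun m n hmn => hy hmn⟩

lemma memLp_cexp_linNoise_sub [IsProbabilityMeasure μ] (c : κ → ℝ) (i : κ → Idx d) (y : E d)
    (m : ℂ) : MemLp (fun η => Complex.exp ((linNoise c i y η : ℂ) * I) - m) 2 μ := by
  have hm := measurable_linNoise c i y
  refine MemLp.of_bound (Measurable.aestronglyMeasurable (by fun_prop)) (1 + ‖m‖)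
    (Eventually.of_forall fun η => ?_)
  refine (norm_sub_le _ _).trans ?_
  rw [Complex.norm_exp_ofReal_mul_I]

/-- Trigonometric functionals of the noise are uncorrelated with shift invariant events. -/
lemma IsNoise.setIntegral_cexp_of_invariant {ν : Measure (E d)} [f.HasTemperateGrowth]
    [ν.HasTemperateGrowth] (hν : IsFourierTransform f ν) (h0 : ν {0} = 0)
    (hμ : IsNoise f (fun i η => η i) μ) {B : Set (Idx d → ℝ)} (hB : MeasurableSet B)
    (hinv : ∀ y : E d, shiftNoise y ⁻¹' B =ᵐ[μ] B) (c : κ → ℝ) (i : κ → Idx d) :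
    ∫ η in B, Complex.exp ((linNoise c i 0 η : ℂ) * I) ∂μ =
      μ.real B * ∫ η, Complex.exp ((linNoise c i 0 η : ℂ) * I) ∂μ := by
  have := hμ.gaussian.isProbabilityMeasure
  set V := Var[linNoise c i 0; μ] with hV
  have hV0 : 0 ≤ V := variance_nonneg _ _
  set m : ℝ := Real.exp (-V / 2) with hm
  set e : E d → (Idx d → ℝ) → ℂ := fun y η => Complex.exp ((linNoise c i y η : ℂ) * I) with he
  have hem : ∀ y, Measurable (e y) := fun y => by
    have := measurable_linNoise c i y
    fun_prop
  have hei : ∀ y, Integrable (e y) μ := fun y => by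
    simpa using (memLp_cexp_linNoise_sub (μ := μ) c i y 0).integrable one_le_two
  have hmean : ∀ y, ∫ η, e y η ∂μ = m := fun y => hμ.integral_cexp_linNoise c i y
  -- Shifting both the functional and the event preserves the integral, and the event is invariant
  -- up to null sets.
  have hinvint : ∀ y, ∫ η in B, e y η ∂μ = ∫ η in B, e 0 η ∂μ := by
    intro y
    have hs := hμ.measurePreserving_shiftNoise y
    have hcomp : ∀ η, e y η = e 0 (shiftNoise y η) := by
      intro η
      simp only [he, linNoise, shiftNoise_shiftNoise, zero_add]
    calc ∫ η in B, e y η ∂μ = ∫ η in shiftNoise y ⁻¹' B, e y η ∂μ :=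
          (setIntegral_congr_set (hinv y)).symm
      _ = ∫ η, B.indicator (e 0) (shiftNoise y η) ∂μ := by
          rw [← integral_indicator (hs.measurable hB)]
          congr 1
          funext η
          by_cases h : shiftNoise y η ∈ B <;> simp [Set.indicator, h, hcomp]
      _ = ∫ η, B.indicator (e 0) η ∂(μ.map (shiftNoise y)) :=
          (integral_map hs.measurable.aemeasurable
            ((hem 0).indicator hB).aestronglyMeasurable).symm
      _ = _ := by rw [hs.map_eq, integral_indicator hB]
  change ∫ η in B, e 0 η ∂μ = μ.real B * ∫ η, e 0 η ∂μ
  rw [hmean]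
  set q : ℂ := ∫ η in B, e 0 η ∂μ - μ.real B * m with hq
  have hZ : ∀ y, ∫ η in B, (e y η - m) ∂μ = q := by
    intro y
    rw [integral_sub (hei y).integrableOn (integrable_const _).integrableOn, hinvint y]
    simp [hq]
  have hcov : ∀ x y, ∫ η, (e x η - m) * (starRingEnd ℂ) (e y η - m) ∂μ =
      ((Real.exp (-V + cov[linNoise c i x, linNoise c i y; μ]) - Real.exp (-V) : ℝ) : ℂ) := by
    intro x y
    have h1 : ∀ η, (e x η - m) * (starRingEnd ℂ) (e y η - m) =
        Complex.exp (((linNoise c i x η - linNoise c i y η : ℝ) : ℂ) * I) - m * e x η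
          - m * (starRingEnd ℂ) (e y η) + m * m := by
      intro η
      have h2 : Complex.exp (((linNoise c i x η - linNoise c i y η : ℝ) : ℂ) * I) =
          e x η * (starRingEnd ℂ) (e y η) := by
        simp only [he, ← Complex.exp_conj, map_mul, Complex.conj_ofReal, Complex.conj_I,
          ← Complex.exp_add]
        congr 1
        push_cast
        ring
      rw [h2, map_sub, Complex.conj_ofReal]
      ring
    have hi1 : Integrable (fun η =>
        Complex.exp (((linNoise c i x η - linNoise c i y η : ℝ) : ℂ) * I)) μ := by
      have h3 := measurable_linNoise c i x
      have h4 := measurable_linNoise c i y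
      refine Integrable.of_bound (Measurable.aestronglyMeasurable (by fun_prop)) 1
        (Eventually.of_forall fun η => ?_)
      rw [Complex.norm_exp_ofReal_mul_I]
    have hi2 : Integrable (fun η => (starRingEnd ℂ) (e y η)) μ :=
      Complex.conjCLE.toContinuousLinearMap.integrable_comp (hei y)
    have hc : ∫ η, (starRingEnd ℂ) (e y η) ∂μ = m := by
      rw [integral_conj, hmean, Complex.conj_ofReal]
    simp_rw [h1]
    have hi3 : Integrable (fun η =>
        Complex.exp (((linNoise c i x η - linNoise c i y η : ℝ) : ℂ) * I) - m * e x η) μ :=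
      hi1.sub ((hei x).const_mul _)
    have hi4 : Integrable (fun η =>
        Complex.exp (((linNoise c i x η - linNoise c i y η : ℝ) : ℂ) * I) - m * e x η
          - m * (starRingEnd ℂ) (e y η)) μ := hi3.sub (hi2.const_mul _)
    rw [integral_add hi4 (integrable_const _), integral_sub hi3 (hi2.const_mul _),
      integral_sub hi1 ((hei x).const_mul _), integral_const_mul, integral_const_mul, hc, hmean,
      hμ.integral_cexp_linNoise_sub]
    have hmm : (m : ℂ) * m = Real.exp (-V) := by
      rw [hm, ← Complex.ofReal_mul, ← Real.exp_add]
      congr 2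
      ring
    simp only [integral_const, probReal_univ, one_smul, hmm]
    push_cast
    ring
  -- With `N + 1` translates and `δ = 1 / (N + 1)`, each row of the covariance matrix sums to at
  -- most `1 + 2 * δ * (N + 1) = 3`: a diagonal term at most `1`, the others at most `2 * δ` by
  -- `|exp c - 1| ≤ 2 * |c|`. Then `‖(N + 1) * q‖² ≤ 3 * (N + 1)`.
  have hbound : ∀ N : ℕ, ‖q‖ ^ 2 * ((N : ℝ) + 1) ≤ 3 := by
    intro N
    obtain ⟨y, hy⟩ := hμ.exists_seq_covariance_le hν h0 c i (δ := 1 / ((N : ℝ) + 1))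
      (by positivity)
    have hmem : ∀ k : ℕ, MemLp (fun η => e (y k) η - m) 2 μ :=
      fun k => memLp_cexp_linNoise_sub (μ := μ) c i (y k) m
    have hS := sq_norm_setIntegral_le (memLp_finsetSum (Finset.range (N + 1)) fun k _ => hmem k) B
    have hq' : ∫ η in B, ∑ k ∈ Finset.range (N + 1), (e (y k) η - m) ∂μ = ((N : ℂ) + 1) * q := by
      rw [integral_finsetSum _ fun k _ => ((hmem k).integrable one_le_two).integrableOn]
      simp [hZ]
    have hsum := integral_norm_sq_sum (Finset.range (N + 1)) hmem
    have hle : ∫ η, ‖∑ k ∈ Finset.range (N + 1), (e (y k) η - m)‖ ^ 2 ∂μ ≤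
        ∑ k ∈ Finset.range (N + 1), ∑ l ∈ Finset.range (N + 1),
          ((if k = l then 1 else 0) + 2 * (1 / ((N : ℝ) + 1))) := by
      refine (le_abs_self _).trans ?_
      rw [← Real.norm_eq_abs, ← Complex.norm_real]
      rw [hsum]
      refine (norm_sum_le _ _).trans (Finset.sum_le_sum fun k _ => ?_)
      refine (norm_sum_le _ _).trans (Finset.sum_le_sum fun l _ => ?_)
      rw [hcov, Complex.norm_real, Real.norm_eq_abs]
      split_ifs with hkl
      · subst hkl
        rw [covariance_self (measurable_linNoise c i (y k)).aemeasurable, hμ.variance_linNoise,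
          neg_add_cancel, Real.exp_zero]
        have h5 : Real.exp (-V) ≤ 1 := Real.exp_le_one_iff.2 (by linarith)
        have h6 := Real.exp_pos (-V)
        rw [abs_of_nonneg (by linarith)]
        have : 0 ≤ 2 * (1 / ((N : ℝ) + 1)) := by positivity
        linarith
      · have h5 := hy k l hkl
        have h6 : Real.exp (-V) ≤ 1 := Real.exp_le_one_iff.2 (by linarith)
        have h7 : |cov[linNoise c i (y k), linNoise c i (y l); μ]| ≤ 1 := by
          refine h5.trans ?_
          rw [div_le_one (by positivity)]
          simp
        have h8 := Real.abs_exp_sub_one_le h7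
        rw [Real.exp_add, ← mul_sub_one, abs_mul, Real.abs_exp, zero_add]
        calc _ ≤ 1 * (2 * |cov[linNoise c i (y k), linNoise c i (y l); μ]|) := by gcongr
          _ ≤ _ := by rw [one_mul]; gcongr
    have hcalc : ∑ k ∈ Finset.range (N + 1), ∑ l ∈ Finset.range (N + 1),
          ((if k = l then (1 : ℝ) else 0) + 2 * (1 / ((N : ℝ) + 1))) = 3 * ((N : ℝ) + 1) := by
      have : ∀ k ∈ Finset.range (N + 1), ∑ l ∈ Finset.range (N + 1),
          ((if k = l then (1 : ℝ) else 0) + 2 * (1 / ((N : ℝ) + 1))) = 3 := by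
        intro k hk
        rw [Finset.sum_add_distrib, Finset.sum_ite_eq, if_pos hk]
        simp
        field_simp
        norm_num
      rw [Finset.sum_congr rfl this]
      simp
      ring
    have hfin : ‖((N : ℂ) + 1) * q‖ ^ 2 ≤ 3 * ((N : ℝ) + 1) := by
      rw [← hq', ← hcalc]
      exact hS.trans hle
    have hN : ‖(N : ℂ) + 1‖ = (N : ℝ) + 1 := by
      have : ((N : ℂ) + 1) = (((N + 1 : ℕ) : ℝ) : ℂ) := by push_cast; rfl
      rw [this, Complex.norm_real, Real.norm_eq_abs, abs_of_nonneg (by positivity)]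
      push_cast
      rfl
    rw [norm_mul, hN, mul_pow] at hfin
    have hpos : (0 : ℝ) < (N : ℝ) + 1 := by positivity
    nlinarith
  have hq0 : ‖q‖ ^ 2 ≤ 0 := by
    by_contra hcon
    rw [not_le] at hcon
    obtain ⟨N, hN⟩ := exists_nat_gt (3 / ‖q‖ ^ 2)
    rw [div_lt_iff₀ hcon] at hN
    have := hbound N
    nlinarith
  have : q = 0 := by
    have h9 : ‖q‖ = 0 := by nlinarith [norm_nonneg q, sq_nonneg ‖q‖]
    exact norm_eq_zero.1 h9
  exact sub_eq_zero.1 this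

end

/-- If the spectral measure does not charge the origin, shift invariant events of the noise are
trivial. -/
theorem IsNoise.measure_eq_zero_or_one {f ν : Measure (E d)} {μ : Measure (Idx d → ℝ)}
    [f.HasTemperateGrowth] [ν.HasTemperateGrowth] (hν : IsFourierTransform f ν) (h0 : ν {0} = 0)
    (hμ : IsNoise f (fun i η => η i) μ) {B : Set (Idx d → ℝ)} (hB : MeasurableSet B)
    (hinv : ∀ y : E d, shiftNoise y ⁻¹' B =ᵐ[μ] B) : μ B = 0 ∨ μ B = 1 := by
  have := hμ.gaussian.isProbabilityMeasure
  have hfin : IsFiniteMeasure (μ B • μ) := Measure.smul_finite μ (measure_ne_top μ B)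
  have heq : μ.restrict B = μ B • μ := by
    refine ext_of_integral_cexp_sum fun s c => ?_
    have h := hμ.setIntegral_cexp_of_invariant hν h0 hB hinv c fun k : s => (k : Idx d)
    simp only [linNoise, shiftNoise, SchwartzMap.compSubConstCLM_zero,
      ContinuousLinearMap.id_apply, Prod.mk.eta] at h
    rw [h, integral_smul_measure, Complex.real_smul, measureReal_def]
  -- Evaluating both measures at `B` gives `μ B = μ B * μ B`.
  have h2 := congrArg (fun ρ : Measure (Idx d → ℝ) => ρ B) heq
  simp only [Measure.restrict_apply_self, Measure.smul_apply, smul_eq_mul] at h2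
  by_cases hz : μ B = 0
  · exact Or.inl hz
  · refine Or.inr ?_
    rw [← ENNReal.mul_right_inj hz (measure_ne_top μ B), ← h2, mul_one]

/-- The field is the image of the noise under a map intertwining the shifts, so invariant sets of
paths pull back to invariant events of the noise. -/
theorem isErgodicField_shiftField {Ω : Type*} [MeasurableSpace Ω] {f ν : Measure (E d)}
    {W : Idx d → Ω → ℝ} {P : Measure Ω} [f.HasTemperateGrowth] [ν.HasTemperateGrowth]
    (hν : IsFourierTransform f ν) (h0 : ν {0} = 0) (hW : IsNoise f W P) {G : (Idx d → ℝ) → ℝ}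
    (hG : Measurable G) : IsErgodicField P (shiftField W G) := by
  intro A hA hinv
  have hΨ := measurable_shiftField_pi hG
  have hJ := hW.measurable_joint
  have h2 : P.map (fun ω x => shiftField W G x ω) = (P.map fun ω i => W i ω).map
      (fun (η : Idx d → ℝ) (x : E d) => G (shiftNoise x η)) := by
    rw [Measure.map_map hΨ hJ]
    rfl
  rw [h2, Measure.map_apply hΨ hA]
  refine hW.canonical.measure_eq_zero_or_one hν h0 (hΨ hA) fun y => ?_
  have h3 := hinv y
  rw [h2] at h3
  have h4 := hΨ.quasiMeasurePreserving (P.map fun ω i => W i ω) |>.preimage_ae_eq h3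
  have h5 : shiftNoise y ⁻¹' ((fun (η : Idx d → ℝ) (x : E d) => G (shiftNoise x η)) ⁻¹' A) =
      (fun (η : Idx d → ℝ) (x : E d) => G (shiftNoise x η)) ⁻¹'
        ((fun (u : E d → ℝ) (x : E d) => u (x + y)) ⁻¹' A) := by
    ext η
    simp [shiftNoise_shiftNoise]
  rw [h5]
  exact h4

/-! ### Failure of ergodicity when the spectral measure charges the origin -/

lemma gaussMass_mul_gaussMass_eq {b c : ℝ} (hb : 0 < b) (hc : 0 < c) :
    gaussMass d b * gaussMass d c = gaussMass d (b + c) * gaussMass d (b * c / (b + c)) := by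
  have hpi := Real.pi_pos
  unfold gaussMass
  rw [← Real.mul_rpow (by positivity) (by positivity),
    ← Real.mul_rpow (by positivity) (by positivity)]
  congr 1
  field_simp

lemma integral_gauss_mul_gauss_sub {b c : ℝ} (hb : 0 < b) (hc : 0 < c) (w : E d) :
    ∫ x : E d, Real.exp (-b * ‖x‖ ^ 2) * Real.exp (-c * ‖x - w‖ ^ 2) =
      gaussMass d (b + c) * Real.exp (-(b * c / (b + c)) * ‖w‖ ^ 2) := by
  have h : ∀ x : E d, Real.exp (-b * ‖x‖ ^ 2) * Real.exp (-c * ‖x - w‖ ^ 2) =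
      Real.exp (-c * ‖w‖ ^ 2) * Real.exp (-(b + c) * ‖x‖ ^ 2 + (2 * c) * inner ℝ w x) := by
    intro x
    rw [← Real.exp_add, ← Real.exp_add, norm_sub_sq_real, real_inner_comm]
    congr 1
    ring
  simp_rw [h]
  rw [integral_const_mul, integral_rexp_gauss (by positivity), mul_left_comm, ← Real.exp_add]
  congr 2
  field_simp
  ring

lemma integrable_gauss_mul_gauss_sub (f : Measure (E d)) [f.HasTemperateGrowth] {b c : ℝ}
    (hb : 0 < b) (hc : 0 < c) (y : E d) :
    Integrable (fun p : E d × E d =>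
      Real.exp (-b * ‖p.1‖ ^ 2) * Real.exp (-c * ‖p.1 - p.2 - y‖ ^ 2)) (volume.prod f) := by
  have := sigmaFinite_of_hasTemperateGrowth f
  set m := min b c with hm
  have hm0 : 0 < m := lt_min hb hc
  have h1 : Integrable (fun x : E d => Real.exp (-(m / 2) * ‖x‖ ^ 2)) volume :=
    (gaussR d (m / 2) (by positivity)).integrable
  have h2 : Integrable (fun z : E d => Real.exp (-(m / 4) * ‖z - -y‖ ^ 2)) f :=
    (SchwartzMap.compSubConstCLM ℝ (-y) (gaussR d (m / 4) (by positivity))).integrable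
  refine (h1.mul_prod h2).mono' (Continuous.aestronglyMeasurable (by fun_prop))
    (Eventually.of_forall fun p => ?_)
  rw [Real.norm_eq_abs, abs_mul, Real.abs_exp, Real.abs_exp, ← Real.exp_add, ← Real.exp_add,
    Real.exp_le_exp]
  -- Since `z + y = x - (x - z - y)`, part of the joint exponent can be traded for decay in `z`,
  -- which leaves a product of a Gaussian in `x` and one in `z`.
  have h3 : ‖p.2 - -y‖ ≤ ‖p.1‖ + ‖p.1 - p.2 - y‖ := by
    have : p.2 - -y = p.1 - (p.1 - p.2 - y) := by abel
    rw [this]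
    exact norm_sub_le _ _
  have h4 : ‖p.2 - -y‖ ^ 2 ≤ 2 * ‖p.1‖ ^ 2 + 2 * ‖p.1 - p.2 - y‖ ^ 2 := by
    have h5 : ‖p.2 - -y‖ ^ 2 ≤ (‖p.1‖ + ‖p.1 - p.2 - y‖) ^ 2 := by gcongr
    nlinarith [sq_nonneg (‖p.1‖ - ‖p.1 - p.2 - y‖)]
  have h6 : m * ‖p.1‖ ^ 2 ≤ b * ‖p.1‖ ^ 2 := by gcongr; exact min_le_left _ _
  have h7 : m * ‖p.1 - p.2 - y‖ ^ 2 ≤ c * ‖p.1 - p.2 - y‖ ^ 2 := by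
    gcongr; exact min_le_right _ _
  have h8 : 0 ≤ m * ‖p.1 - p.2 - y‖ ^ 2 := by positivity
  nlinarith [mul_le_mul_of_nonneg_left h4 hm0.le]

/-- The Gaussian probability density whose Fourier transform is `exp (-a ‖z‖²)`. -/
noncomputable def gaussDensity (d : ℕ) (a : ℝ) (ha : 0 < a) : 𝓢(E d, ℝ) :=
  (gaussMass d (1 / (4 * a)))⁻¹ • gaussR d (1 / (4 * a)) (by positivity)

/-- Gaussian densities form a convolution semigroup, so the covariance depends on `a` and `a'` only
through their sum; the duality with `ν` then expresses it spectrally. -/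
lemma pairing_gaussDensity {f ν : Measure (E d)} [f.HasTemperateGrowth]
    (hν : IsFourierTransform f ν) {a a' : ℝ} (ha : 0 < a) (ha' : 0 < a') (y : E d) :
    pairing f (gaussDensity d a ha) (SchwartzMap.compSubConstCLM ℝ y (gaussDensity d a' ha')) =
      ((2 * Real.pi) ^ d)⁻¹ * (∫ z, gaussC (a + a') (by positivity) y z ∂ν).re := by
  have := sigmaFinite_of_hasTemperateGrowth f
  have hpi := Real.pi_pos
  set b := 1 / (4 * a) with hbdef
  set c := 1 / (4 * a') with hcdef
  have hb : 0 < b := by positivity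
  have hc : 0 < c := by positivity
  have hs : b * c / (b + c) = 1 / (4 * (a + a')) := by
    rw [hbdef, hcdef]
    field_simp
    ring
  have hmb := gaussMass_pos d hb
  have hmc := gaussMass_pos d hc
  have h1 : pairing f (gaussDensity d a ha)
      (SchwartzMap.compSubConstCLM ℝ y (gaussDensity d a' ha')) =
      (gaussMass d b)⁻¹ * (gaussMass d c)⁻¹ *
        ∫ x : E d, ∫ z, Real.exp (-b * ‖x‖ ^ 2) * Real.exp (-c * ‖x - z - y‖ ^ 2) ∂f := by
    rw [pairing, ← integral_const_mul]
    congr 1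
    funext x
    simp only [gaussDensity, SchwartzMap.compSubConstCLM_apply, smul_apply,
      gaussR_apply, smul_eq_mul, integral_const_mul, ← hbdef, ← hcdef]
    ring
  have h2 : ∫ x : E d, ∫ z, Real.exp (-b * ‖x‖ ^ 2) * Real.exp (-c * ‖x - z - y‖ ^ 2) ∂f =
      gaussMass d (b + c) * ∫ z, Real.exp (-(1 / (4 * (a + a'))) * ‖z + y‖ ^ 2) ∂f := by
    rw [integral_integral_swap (integrable_gauss_mul_gauss_sub f hb hc y), ← integral_const_mul]
    congr 1
    funext z
    simp_rw [sub_sub]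
    rw [integral_gauss_mul_gauss_sub hb hc, hs]
  rw [h1, h2, integral_gaussC_eq hν, Complex.ofReal_re, ← mul_assoc, ← mul_assoc]
  congr 1
  have h3 := gaussMass_mul_gaussMass_eq (d := d) hb hc
  have h4 := gaussMass_mul_gaussMass (d := d) (a + a') (by positivity)
  rw [hs] at h3
  have hm1 := gaussMass_pos d (show 0 < b + c by positivity)
  have hm2 := gaussMass_pos d (show 0 < a + a' by positivity)
  have hm3 := gaussMass_pos d (show 0 < 1 / (4 * (a + a')) by positivity)
  rw [← mul_inv, h3, ← h4]
  field_simp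

/-- Expanding the square, `‖x n - x m‖² = F (n + n) - 2 F (n + m) + F (m + m)`, which tends to `v -
2v + v = 0`. -/
lemma cauchySeq_of_tendsto_inner {H : Type*} [NormedAddCommGroup H] [InnerProductSpace ℝ H]
    {x : ℕ → H} {F : ℕ → ℝ} {v : ℝ} (hF : Tendsto F atTop (𝓝 v))
    (hx : ∀ n m, inner ℝ (x n) (x m) = F (n + m)) : CauchySeq x := by
  rw [cauchySeq_iff_tendsto_dist_atTop_0]
  have h1 : Tendsto (fun p : ℕ × ℕ => F (p.1 + p.1) - 2 * F (p.1 + p.2) + F (p.2 + p.2)) atTop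
      (𝓝 (v - 2 * v + v)) := by
    have hfst : Tendsto (Prod.fst : ℕ × ℕ → ℕ) atTop atTop := by
      rw [← prod_atTop_atTop_eq]; exact tendsto_fst
    have hsnd : Tendsto (Prod.snd : ℕ × ℕ → ℕ) atTop atTop := by
      rw [← prod_atTop_atTop_eq]; exact tendsto_snd
    exact ((hF.comp (hfst.atTop_add_atTop hfst)).sub
      ((hF.comp (hfst.atTop_add_atTop hsnd)).const_mul 2)).add
      (hF.comp (hsnd.atTop_add_atTop hsnd))
  have h2 := (Real.continuous_sqrt.tendsto _).comp h1
  have h3 : v - 2 * v + v = 0 := by ring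
  rw [h3, Real.sqrt_zero] at h2
  refine h2.congr fun p => ?_
  rw [Function.comp_apply, dist_eq_norm, ← hx, ← hx, ← hx, real_inner_self_eq_norm_sq,
    real_inner_self_eq_norm_sq, ← norm_sub_sq_real, Real.sqrt_sq (norm_nonneg _)]

section

variable {f ν : Measure (E d)} {μ : Measure (Idx d → ℝ)}

/-- The index of the Wiener integral of a Gaussian density at time one. -/
noncomputable def gaussIdx (d n : ℕ) : Idx d :=
  (1, gaussDensity d ((n : ℝ) + 1) (by positivity))

lemma IsNoise.integral_gaussIdx_mul [f.HasTemperateGrowth] (hν : IsFourierTransform f ν)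
    (hμ : IsNoise f (fun i η => η i) μ) (n m : ℕ) (y : E d) :
    ∫ η, η (gaussIdx d n) * shiftNoise y η (gaussIdx d m) ∂μ =
      ((2 * Real.pi) ^ d)⁻¹ *
        (∫ z, gaussC (((n + m + 1 : ℕ) : ℝ) + 1) (by positivity) y z ∂ν).re := by
  have := hμ.gaussian.isProbabilityMeasure
  have h := hμ.covariance (gaussIdx d n)
    ((gaussIdx d m).1, SchwartzMap.compSubConstCLM ℝ y (gaussIdx d m).2)
  rw [covariance_eq_sub (hμ.memLp _) (hμ.memLp _), hμ.centered, zero_mul, sub_zero] at h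
  refine Eq.trans h ?_
  have h2 := pairing_gaussDensity hν (a := (n : ℝ) + 1) (a' := (m : ℝ) + 1)
    (by positivity) (by positivity) y
  -- The sum of the two parameters is put in the form `k + 1` with `k = n + m + 1`, the form used in
  -- `tendsto_integral_gaussC_atom`.
  have h3 : (n : ℝ) + 1 + ((m : ℝ) + 1) = ((n + m + 1 : ℕ) : ℝ) + 1 := by
    push_cast
    ring
  simp only [h3] at h2
  simp only [gaussIdx, min_self, NNReal.coe_one, one_mul]
  exact h2

/-- If the spectral measure has an atom at the origin, there is a nonconstant functional of the
noise that is invariant under all shifts. -/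
lemma IsNoise.exists_invariant [f.HasTemperateGrowth] [ν.HasTemperateGrowth]
    (hν : IsFourierTransform f ν) (h0 : ν {0} ≠ 0) (hμ : IsNoise f (fun i η => η i) μ) :
    ∃ G : (Idx d → ℝ) → ℝ, Measurable G ∧ MemLp G 2 μ ∧
      (∀ y : E d, (fun η => G (shiftNoise y η)) =ᵐ[μ] G) ∧
      ¬ ∃ a : ℝ, G =ᵐ[μ] Function.const _ a := by
  have := hμ.gaussian.isProbabilityMeasure
  have := isLocallyFiniteMeasure_of_hasTemperateGrowth ν
  have hpi := Real.pi_pos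
  set v : ℝ := ((2 * Real.pi) ^ d)⁻¹ * ν.real {0} with hv
  have hfin : ν {0} ≠ ∞ := isCompact_singleton.measure_lt_top.ne
  have hvpos : 0 < v := by
    have : 0 < ν.real {0} := ENNReal.toReal_pos h0 hfin
    positivity
  let F : E d → ℕ → ℝ := fun y k => ((2 * Real.pi) ^ d)⁻¹ *
    (∫ z, gaussC (((k + 1 : ℕ) : ℝ) + 1) (by positivity) y z ∂ν).re
  have hF : ∀ y, Tendsto (F y) atTop (𝓝 v) := fun y =>
    ((tendsto_integral_gaussC_atom ν y).comp (tendsto_add_atTop_nat 1)).const_mul _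
  let X : ℕ → Lp ℝ 2 μ := fun n => (hμ.memLp (gaussIdx d n)).toLp _
  have hs : ∀ y, MeasurePreserving (shiftNoise y) μ μ := hμ.measurePreserving_shiftNoise
  let T : E d → Lp ℝ 2 μ → Lp ℝ 2 μ := fun y => Lp.compMeasurePreserving (shiftNoise y) (hs y)
  have hT : ∀ y, Continuous (T y) := fun y => (Lp.isometry_compMeasurePreserving (hs y)).continuous
  have hTX : ∀ y n m, inner ℝ (X n) (T y (X m)) = F y (n + m) := by
    intro y n m
    rw [L2.inner_def]
    refine Eq.trans (integral_congr_ae ?_) (hμ.integral_gaussIdx_mul hν n m y)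
    have h1 := (hμ.memLp (gaussIdx d n)).coeFn_toLp
    have h2 := Lp.coeFn_compMeasurePreserving (X m) (hs y)
    have h3 := (hs y).quasiMeasurePreserving.ae_eq_comp (hμ.memLp (gaussIdx d m)).coeFn_toLp
    filter_upwards [h1, h2, h3] with η h1 h2 h3
    simp only [T]
    rw [h2, h3]
    simp only [X, RCLike.inner_apply, conj_trivial]
    rw [h1, mul_comm]
    rfl
  have hXX : ∀ n m, inner ℝ (X n) (X m) = F 0 (n + m) := by
    intro n m
    rw [← hTX 0 n m]
    congr 1
    have : shiftNoise (0 : E d) = id := by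
      funext η i
      simp [shiftNoise]
    refine Lp.ext ?_
    refine EventuallyEq.trans ?_ (Lp.coeFn_compMeasurePreserving (X m) (hs 0)).symm
    rw [this]
    rfl
  obtain ⟨g, hg⟩ := cauchySeq_tendsto_of_complete (cauchySeq_of_tendsto_inner (hF 0) hXX)
  have hdouble : Tendsto (fun n : ℕ => n + n) atTop atTop := tendsto_id.atTop_add_atTop tendsto_id
  have hgg : inner ℝ g g = v :=
    tendsto_nhds_unique ((hg.inner hg).congr fun n => hXX n n) ((hF 0).comp hdouble)
  have hgT : ∀ y, inner ℝ g (T y g) = v := fun y =>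
    tendsto_nhds_unique ((hg.inner (((hT y).tendsto g).comp hg)).congr fun n => hTX y n n)
      ((hF y).comp hdouble)
  -- The shift is an isometry and `⟨g, T y g⟩ = v = ‖g‖²`: equality in Cauchy–Schwarz forces `T y g
  -- = g`.
  have hTg : ∀ y, T y g = g := by
    intro y
    have hnorm : ‖T y g‖ = ‖g‖ := Lp.norm_compMeasurePreserving g (hs y)
    have h1 := norm_sub_sq_real g (T y g)
    rw [hgT, hnorm, ← real_inner_self_eq_norm_sq g, hgg] at h1
    have h2 : ‖g - T y g‖ = 0 := by
      have : ‖g - T y g‖ ^ 2 = 0 := by linarith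
      exact pow_eq_zero_iff two_ne_zero |>.1 this
    exact (sub_eq_zero.1 (norm_eq_zero.1 h2)).symm
  refine ⟨g, (Lp.stronglyMeasurable g).measurable, Lp.memLp g, fun y => ?_, ?_⟩
  · have h1 := Lp.coeFn_compMeasurePreserving g (hs y)
    have h2 : Lp.compMeasurePreserving (shiftNoise y) (hs y) g = g := hTg y
    rw [h2] at h1
    exact h1.symm
  · rintro ⟨a, ha⟩
    -- As a limit of centered variables, `g` is orthogonal to constants. Were it constant, it would
    -- be orthogonal to itself, against `v > 0`.
    have hone : MemLp (fun _ : Idx d → ℝ => (1 : ℝ)) 2 μ := memLp_const 1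
    have hX0 : ∀ n, inner ℝ (X n) (hone.toLp _) = (0 : ℝ) := by
      intro n
      rw [L2.inner_def]
      refine Eq.trans (integral_congr_ae ?_) (hμ.centered (gaussIdx d n))
      filter_upwards [(hμ.memLp (gaussIdx d n)).coeFn_toLp, hone.coeFn_toLp] with η h1 h2
      rw [h1, h2]
      simp
    have hg0 : inner ℝ g (hone.toLp _) = (0 : ℝ) :=
      tendsto_nhds_unique ((hg.inner tendsto_const_nhds).congr hX0) tendsto_const_nhds
    have hga : g = a • hone.toLp _ := by
      refine Lp.ext ?_
      filter_upwards [ha, Lp.coeFn_smul a (hone.toLp _), hone.coeFn_toLp] with η h1 h2 h3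
      rw [h1, h2, Pi.smul_apply, h3]
      simp
    have h3 : inner ℝ g g = (0 : ℝ) := by
      conv_lhs => rw [hga, inner_smul_right, ← hga, hg0, mul_zero]
    linarith

end

theorem exists_not_isErgodicField {Ω : Type*} [MeasurableSpace Ω] {f ν : Measure (E d)}
    {W : Idx d → Ω → ℝ} {P : Measure Ω} [f.HasTemperateGrowth] [ν.HasTemperateGrowth]
    (hν : IsFourierTransform f ν) (h0 : ν {0} ≠ 0) (hW : IsNoise f W P) :
    ∃ G : (Idx d → ℝ) → ℝ, IsL2Functional W P G ∧
      IsContinuousInProbability P (shiftField W G) ∧ ¬ IsErgodicField P (shiftField W G) := by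
  have := hW.gaussian.isProbabilityMeasure
  obtain ⟨G, hG, hG2, hinv, hconst⟩ := hW.canonical.exists_invariant hν h0
  have hJ := hW.measurable_joint
  have hΨ := measurable_shiftField_pi hG
  have hX : Measurable fun ω x => shiftField W G x ω := hΨ.comp hJ
  have hae : ∀ y, shiftField W G y =ᵐ[P] fun ω => G fun i => W i ω := fun y =>
    ae_of_ae_map hJ.aemeasurable (hinv y)
  refine ⟨G, ⟨hG, ?_⟩, fun x ε hε => ?_, fun herg => hconst ?_⟩
  · exact (memLp_map_measure_iff hG.aestronglyMeasurable hJ.aemeasurable).1 hG2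
  · refine tendsto_const_nhds.congr fun x' => ?_
    refine (measure_mono_null (fun ω hω => ?_)
      (ae_iff.1 ((hae x').trans (hae x).symm))).symm
    intro hcon
    simp only [Set.mem_ofPred_eq] at hω
    rw [hcon, edist_self] at hω
    exact absurd hω (not_le.2 hε)
  -- The path events `{u | u 0 ∈ U}` are invariant up to null sets because the field does not vary
  -- with `x`. Ergodicity would make `G ∈ U` trivial for every measurable `U`, hence `G` almost
  -- surely constant.
  · refine exists_eventuallyEq_const_of_forall_separating MeasurableSet fun U hU => ?_
    have hA : MeasurableSet {u : E d → ℝ | u 0 ∈ U} := measurable_pi_apply 0 hU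
    have hG0 : P.map (fun ω x => shiftField W G x ω) {u : E d → ℝ | u 0 ∈ U} =
        (P.map fun ω i => W i ω) (G ⁻¹' U) := by
      rw [Measure.map_apply hX hA, Measure.map_apply hJ (hG hU)]
      refine measure_congr ?_
      filter_upwards [hae 0] with ω hω
      exact congrArg (fun t => t ∈ U) hω
    have h := herg _ hA fun y => ?_
    · rw [hG0] at h
      have := hW.canonical.gaussian.isProbabilityMeasure
      rcases h with h | h
      · right
        exact measure_eq_zero_iff_ae_notMem.1 h
      · left
        exact (mem_ae_iff_prob_eq_one (hG hU)).2 h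
    · have hu : ∀ᵐ u ∂(P.map fun ω x => shiftField W G x ω), u (0 + y) = u 0 := by
        refine (ae_map_iff hX.aemeasurable (measurableSet_eq_fun (measurable_pi_apply _)
          (measurable_pi_apply _))).2 ?_
        filter_upwards [hae (0 + y), hae 0] with ω h1 h2
        rw [h1, h2]
      filter_upwards [hu] with u hu
      exact congrArg (fun t => t ∈ U) hu

end NoiseErgodicity

open NoiseErgodicity in
theorem theorem3p5 {d : ℕ} (f : Measure (E d)) (hf_temp : f.HasTemperateGrowth)
    (hf_pos : IsNonnegDefinite f)
    {Ω : Type*} [MeasurableSpace Ω] (P : Measure Ω) [IsProbabilityMeasure P]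
    (W : Idx d → Ω → ℝ) (hW : IsNoise f W P) :
    (∀ G : (Idx d → ℝ) → ℝ, IsL2Functional W P G → IsStationaryField P (shiftField W G)) ∧
    ((∀ G : (Idx d → ℝ) → ℝ, IsL2Functional W P G →
        IsContinuousInProbability P (shiftField W G) → IsErgodicField P (shiftField W G)) ↔
      spectralMeasure f {0} = 0) := by
  -- Only temperateness and the Fourier relation are used from here on, so uniqueness of the
  -- spectral measure plays no role.
  obtain ⟨hν_temp, hν⟩ := spectralMeasure_spec f hf_pos
  refine ⟨fun G hG => isStationaryField_shiftField hW hG.1, fun h => ?_, fun h0 G hG _ =>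
    isErgodicField_shiftField hν h0 hW hG.1⟩
  by_contra h0
  obtain ⟨G, hG, hcont, hnot⟩ := exists_not_isErgodicField hν h0 hW
  exact hnot (h G hG hcont)
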